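/- Let $\alpha>1$, $1/\alpha+1/\beta=1$, $\Phi(u)=|u|^{\alpha-1}\operatorname{sgn}u$, let $r,p$ be positive continuous functions on $[a,\infty)$, and let $\tau\in C^1([a,\infty))$ satisfy $\tau'>0$ and $\tau(t)\le t$. Consider the equation $$(r(t)\Phi(y'))'=p(t)\Phi(y(\tau(t))).\qquad(\mathrm E)$$ Let $\mathcal{IS}$ be the set of all $y$ that, for large $t$, are positive classical solutions of (E) ($y\in C^1$, $y^{[1]}:=r\Phi(y')\in C^1$) with $y'>0$. Write $y\in\mathcal{IS}_{\infty,\infty}$ if $y\in\mathcal{IS}$, $y\to\infty$ and $y^{[1]}\to\infty$, and $y\in\mathcal{IS}_{\infty,B}$ if $y\in\mathcal{IS}$, $y\to\infty$ and $y^{[1]}$ tends to a nonzero real number (all limits as $t\to\infty$). An eventually positive measurable function $f$ belongs to $RV(\vartheta)$ if $f(\lambda t)/f(t)\to\lambda^{\vartheta}$ as $t\to\infty$ for every $\lambda>0$; then $L_f(t)=f(t)/t^{\vartheta}$; $SV=RV(0)$. Further, $f\in NRV(\vartheta)$ if for some $t_1>0$, $C>0$ and some measurable $\psi$ with $\psi(t)\to0$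 one has $f(t)=Ct^{\vartheta}\exp\int_{t_1}^t\psi(s)/s\,ds$ for $t\ge t_1$. Assume $\int_a^\infty r^{1-\beta}(s)\,ds=\infty$, put $R_D(t)=\int_a^t r^{1-\beta}(s)\,ds$, let $R_D^{-1}$ be its inverse, and put $$\tau_D=R_D\circ\tau\circ R_D^{-1},\quad p_D=(pr^{\beta-1})\circ R_D^{-1},\quad q_D=((\tau_D'\circ R_D)R_D)^{\alpha-1}p,$$ where $\tau_D$ and $q_D$ are defined for all sufficiently large arguments. Assume that $p_D\in RV(-\alpha)$, $\lim_{t\to\infty}L_{p_D}(t)=0$, and $$\limsup_{t\to\infty}\frac{t}{\tau_D(t)}<\infty,\qquad \tau_D'\in SV,\qquad \limsup_{t\to\infty}\tau_D'(t)<\infty .$$ (The first of these conditions includes that $\tau(t)\ge a$, so that $\tau_D$ is defined, for large arguments.) **Theorem.** For every $y\in\mathcal{IS}$ one has $y\circ R_D^{-1}\in NRV(1)$. Moreover, let $t_0\ge a$ be any number with $\tau(t_0)\ge a$ (if $\tau(a)=a$, one may take $t_0=a$). Then for every $y\in\mathcal{IS}$ the following hold. (i) If $\int_{t_0}^\infty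 q_D(s)\,ds=\infty$, then $y\in\mathcal{IS}_{\infty,\infty}$ and there is a function $\varepsilon$ with $\varepsilon(s)\to0$ as $s\to\infty$ such that, for all large $t$, $$y(t)=R_D(t)\exp\left\{\int_{t_0}^t(1+\varepsilon(s))(\beta-1)q_D(s)\,ds\right\}.$$ (ii) If $\int_{t_0}^\infty q_D(s)\,ds<\infty$, then $y\in\mathcal{IS}_{\infty,B}$ with $M:=\lim_{t\to\infty}y^{[1]}(t)\in(0,\infty)$, and there are $A\in\mathbb R$ and a function $\varepsilon$ with $\varepsilon(u)\to0$ as $u\to\infty$ such that, for all large $t$, $$y(t)=A+\int_{t_0}^t M^{\beta-1}r^{1-\beta}(s)\exp\left\{-\int_s^\infty(1+\varepsilon(u))(\beta-1)q_D(u)\,du\right\}ds .$$ In addition, $|y^{[1]}\circ R_D^{-1}-M|\in SV$ and $$\lim_{t\to\infty}\frac{(\tau_D'(R_D(t)))^{\alpha-1}R_D^{\alpha}(t)\,p(t)\,r^{\beta-1}(t)}{M-y^{[1]}(t)}=0 .$$ -/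

import Mathlib

open Filter Topology MeasureTheory

namespace HalfLinear

noncomputable section

/-- `Φ(u) = |u|^(α-1) sgn u`. -/
def Phi (α u : ℝ) : ℝ := |u| ^ (α - 1) * Real.sign u

/-- The quasiderivative `y^[1] = r Φ(y')`. -/
def quasiDeriv (α : ℝ) (r y : ℝ → ℝ) (t : ℝ) : ℝ := r t * Phi α (deriv y t)

/-! ### Regular variation (for germs at infinity of functions on the line) -/

/-- `f ∈ RV(ϑ)`: on some half-line `[b, ∞)` the function `f` is positive and measurable, and
`f (c t) / f t → c ^ ϑ` as `t → ∞` for every `c > 0`. -/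
def RegVar (f : ℝ → ℝ) (ϑ : ℝ) : Prop :=
  (∃ b : ℝ, Measurable (fun t : Set.Ici b => f t) ∧ ∀ t, b ≤ t → 0 < f t) ∧
    ∀ c : ℝ, 0 < c → Tendsto (fun t => f (c * t) / f t) atTop (𝓝 (c ^ ϑ))

/-- `f ∈ SV = RV(0)`. -/
def SlowVar (f : ℝ → ℝ) : Prop := RegVar f 0

/-- The component `L_f(t) = f(t) / t^ϑ` of a function `f ∈ RV(ϑ)`. -/
def slowPart (f : ℝ → ℝ) (ϑ t : ℝ) : ℝ := f t / t ^ ϑ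

/-- `f ∈ NRV(ϑ)`: for some `t₀ > 0`, some `C > 0` and some measurable `ψ` with `ψ → 0`,
`f(t) = C t^ϑ exp (∫_{t₀}^t ψ(s)/s ds)` for all `t ≥ t₀`. -/
def NormRegVar (f : ℝ → ℝ) (ϑ : ℝ) : Prop :=
  ∃ t₀ C : ℝ, ∃ ψ : ℝ → ℝ, 0 < t₀ ∧ 0 < C ∧ Measurable ψ ∧ Tendsto ψ atTop (𝓝 0) ∧
    ∀ t, t₀ ≤ t → IntervalIntegrable (fun s => ψ s / s) volume t₀ t ∧
      f t = C * t ^ ϑ * Real.exp (∫ s in t₀..t, ψ s / s)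

/-! ### The equation `(r Φ(y'))' = p Φ(y ∘ τ)` on `[a, ∞)` and its solutions -/

/-- The class `S`: `y` is, for large `t`, a positive classical solution of
`(r Φ(y'))' = p Φ(y ∘ τ)`. -/
def IsPosSol (a α : ℝ) (r p τ y : ℝ → ℝ) : Prop :=
  ∃ T : ℝ, a ≤ T ∧ ContDiffOn ℝ 1 y (Set.Ioi T) ∧
    ContDiffOn ℝ 1 (quasiDeriv α r y) (Set.Ioi T) ∧
    ∀ t, T < t → 0 < y t ∧ deriv (quasiDeriv α r y) t = p t * Phi α (y (τ t))

/-- The class `IS` of eventually positive and (eventually) increasing solutions. -/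
def IsIncSol (a α : ℝ) (r p τ y : ℝ → ℝ) : Prop :=
  IsPosSol a α r p τ y ∧ ∀ᶠ t in atTop, 0 < deriv y t

/-- The subclass `IS_{∞,∞}`: `y → ∞` and `y^[1] → ∞`. -/
def IsIncSolInfInf (a α : ℝ) (r p τ y : ℝ → ℝ) : Prop :=
  IsIncSol a α r p τ y ∧ Tendsto y atTop atTop ∧ Tendsto (quasiDeriv α r y) atTop atTop

/-- The subclass `IS_{∞,B}`: `y → ∞`, while `y^[1]` has a nonzero real limit. -/
def IsIncSolInfB (a α : ℝ) (r p τ y : ℝ → ℝ) : Prop :=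
  IsIncSol a α r p τ y ∧ Tendsto y atTop atTop ∧
    ∃ M : ℝ, M ≠ 0 ∧ Tendsto (quasiDeriv α r y) atTop (𝓝 M)

/-! ### The transformed data -/

/-- `R_D(t) = ∫_a^t r^(1-β)` for `t ≥ a` (extended by `0` to the left of `a`). -/
def RD (a β : ℝ) (r : ℝ → ℝ) (t : ℝ) : ℝ := ∫ s in Set.Ioc a t, r s ^ (1 - β)

/-- The inverse of `R_D : [a, ∞) → [0, ∞)`. -/
def RDinv (a β : ℝ) (r : ℝ → ℝ) : ℝ → ℝ := Function.invFunOn (RD a β r) (Set.Ici a)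

/-- `τ_D = R_D ∘ τ ∘ R_D⁻¹`. -/
def tauD (a β : ℝ) (r τ : ℝ → ℝ) (s : ℝ) : ℝ := RD a β r (τ (RDinv a β r s))

/-- `p_D = (p r^(β-1)) ∘ R_D⁻¹`. -/
def pD (a β : ℝ) (r p : ℝ → ℝ) (s : ℝ) : ℝ :=
  p (RDinv a β r s) * r (RDinv a β r s) ^ (β - 1)

/-- `q_D = ((τ_D' ∘ R_D) R_D)^(α-1) p`. -/
def qD (a α β : ℝ) (r p τ : ℝ → ℝ) (t : ℝ) : ℝ :=
  (deriv (tauD a β r τ) (RD a β r t) * RD a β r t) ^ (α - 1) * p t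

end

end HalfLinear

/-! The substitution s = R_D(t) removes r: with x = y ∘ R_D⁻¹ and u = y^[1] ∘ R_D⁻¹ the equation
becomes x' = u^(β-1), u' = p_D Φ(x ∘ τ_D). Since x' increases, x ≤ B s x', so s u'/u is at most a
constant times s^α p_D(s) → 0 (`tendsto_logDeriv_u`). Thus u, and with it x', is slowly varying, and
Karamata's theorem (`RatioSlow.karamata`) gives x ∼ s x'. This already yields x ∈ NRV(1) and y → ∞.

Karamata applied to τ_D' gives τ_D ∼ s τ_D', and u(τ_D) ∼ u because τ_D(s) is comparable to s. Hence
u'/u ∼ Q with Q = p_D (s τ_D')^(α-1), and Q ∘ R_D is q_D up to the factor r^(β-1) of the change of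
variable (`tendsto_u'_div`). For x itself a second-order statement is needed: s x' - x has
derivative s x'', slowly varying because x'' ∼ (β-1) Q x', so another use of Karamata gives (log
(x/s))' ∼ (β-1) Q (`tendsto_logDeriv_x_div`).

Everything else is integration of these two equivalences. If q_D has divergent integral, then log
y^[1] → ∞ and log (y/R_D) has the stated form. If it is integrable, log y^[1] converges, y' is
recovered from the tail integral of its logarithmic derivative, and the relation s u' = o(M - u)
(`tendsto_deriv_div_remainder`) gives the slow variation of M - u and the last limit. -/

namespace HalfLinear

/-! ### Slow variation: uniform convergence, Karamata's theorem, logarithmic derivatives. -/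

/-- The ratio condition of slow variation, without positivity and measurability. -/
def RatioSlow (f : ℝ → ℝ) : Prop :=
  ∀ c : ℝ, 0 < c → Tendsto (fun t => f (c * t) / f t) atTop (𝓝 1)

theorem tendsto_const_mul_atTop' {c : ℝ} (hc : 0 < c) :
    Tendsto (fun t : ℝ => c * t) atTop atTop :=
  tendsto_id.const_mul_atTop hc

theorem RatioSlow.mul {f g : ℝ → ℝ} (hf : RatioSlow f) (hg : RatioSlow g) :
    RatioSlow (fun t => f t * g t) := by
  intro c hc
  have := (hf c hc).mul (hg c hc)
  simp only [mul_one] at this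
  refine this.congr fun t => ?_
  rw [div_mul_div_comm]

theorem RatioSlow.rpow {f : ℝ → ℝ} (hf : RatioSlow f) (h0 : ∀ᶠ t in atTop, 0 < f t) (e : ℝ) :
    RatioSlow (fun t => f t ^ e) := by
  intro c hc
  have := (hf c hc).rpow_const (p := e) (Or.inl one_ne_zero)
  rw [Real.one_rpow] at this
  refine this.congr' ?_
  filter_upwards [h0, (tendsto_const_mul_atTop' hc).eventually h0] with t h1 h2
  rw [Real.div_rpow h2.le h1.le]

/-- Slow variation is invariant under asymptotic equivalence up to a constant; it is thereby
transferred from the coefficients to the derivatives of a solution. -/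
theorem RatioSlow.of_tendsto_div {f g : ℝ → ℝ} (hf : RatioSlow f)
    (h0 : ∀ᶠ t in atTop, f t ≠ 0) {l : ℝ} (hl : l ≠ 0)
    (h : Tendsto (fun t => g t / f t) atTop (𝓝 l)) : RatioSlow g := by
  intro c hc
  have h1 := ((h.comp (tendsto_const_mul_atTop' hc)).div h hl).mul (hf c hc)
  rw [div_self hl, mul_one] at h1
  refine h1.congr' ?_
  filter_upwards [h0, (tendsto_const_mul_atTop' hc).eventually h0] with t h2 h3
  simp only [Pi.div_apply, Function.comp]
  field_simp

/-- Additive form of the uniform convergence theorem, for continuous functions (via Baire). -/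
theorem uniform_add_of_continuous {h : ℝ → ℝ} (hc : Continuous h)
    (hv : ∀ v : ℝ, Tendsto (fun x => h (x + v) - h x) atTop (𝓝 0)) (B : ℝ) {η : ℝ} (hη : 0 < η) :
    ∀ᶠ x in atTop, ∀ v ∈ Set.Icc 0 B, |h (x + v) - h x| ≤ η := by
  -- The sets `F n` are closed and cover the line, so by Baire one of them contains a ball.
  let F : ℕ → Set ℝ := fun n => {v | ∀ x : ℝ, n ≤ x → |h (x + v) - h x| ≤ η / 3}
  have hF : ∀ n, IsClosed (F n) := by
    intro n
    simp only [F, Set.ofPred_forall]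
    refine isClosed_iInter fun x => isClosed_iInter fun _ => ?_
    exact isClosed_le (by fun_prop) continuous_const
  have hU : ⋃ n, F n = Set.univ := by
    refine Set.eq_univ_of_forall fun v => ?_
    have h1 := (hv v).eventually (Metric.closedBall_mem_nhds 0 (by positivity : 0 < η / 3))
    obtain ⟨X, hX⟩ := eventually_atTop.1 h1
    refine Set.mem_iUnion.2 ⟨⌈X⌉₊, fun x hx => ?_⟩
    have := hX x ((Nat.le_ceil X).trans hx)
    simpa [Real.norm_eq_abs] using this
  obtain ⟨n, v₀, hv₀⟩ := nonempty_interior_of_iUnion_of_closed hF hU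
  obtain ⟨δ, hδ, hball⟩ := Metric.isOpen_iff.1 isOpen_interior v₀ hv₀
  replace hball := hball.trans interior_subset
  -- Comparing the shifts v₀ and v₀ + w from the common base point x - v₀ makes the bound uniform
  -- over short shifts w.
  have hloc : ∀ x : ℝ, n + v₀ ≤ x → ∀ w, 0 ≤ w → w < δ → |h (x + w) - h x| ≤ 2 * η / 3 := by
    intro x hx w hw0 hw
    have h1 : v₀ + w ∈ F n := hball (by
      rw [Metric.mem_ball, Real.dist_eq, add_sub_cancel_left, abs_of_nonneg hw0]; exact hw)
    have h2 : v₀ ∈ F n := hball (Metric.mem_ball_self hδ)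
    have h3 := h1 (x - v₀) (by linarith)
    have h4 := h2 (x - v₀) (by linarith)
    rw [show x - v₀ + (v₀ + w) = x + w by ring] at h3
    rw [show x - v₀ + v₀ = x by ring] at h4
    rw [abs_le] at *
    constructor <;> linarith
  obtain ⟨d, hd0, hdδ⟩ := exists_between hδ
  -- A finite grid of mesh d < δ reaches all of [0, B]: η/3 for the grid point and 2η/3 for the
  -- short remainder.
  have hfin : ∀ᶠ x in atTop, ∀ k ∈ Finset.range (⌊B / d⌋₊ + 1), |h (x + k * d) - h x| ≤ η / 3 := by
    rw [Filter.eventually_all_finset]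
    intro k _
    filter_upwards [(hv (k * d)).eventually
      (Metric.closedBall_mem_nhds 0 (by positivity : 0 < η / 3))] with x hx
    simpa [Real.norm_eq_abs] using hx
  filter_upwards [hfin, eventually_ge_atTop (n + v₀ : ℝ)] with x hx hxn v hvB
  have hk := hx ⌊v / d⌋₊ (Finset.mem_range.2 (Nat.lt_succ_of_le
    (Nat.floor_le_floor (div_le_div_of_nonneg_right hvB.2 hd0.le))))
  have h1 : (⌊v / d⌋₊ : ℝ) * d ≤ v :=
    (le_div_iff₀ hd0).1 (Nat.floor_le (div_nonneg hvB.1 hd0.le))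
  have h2 : v < (⌊v / d⌋₊ + 1 : ℝ) * d := (div_lt_iff₀ hd0).1 (Nat.lt_floor_add_one (v / d))
  have h0 : 0 ≤ (⌊v / d⌋₊ : ℝ) * d := by positivity
  have h3 := hloc (x + ⌊v / d⌋₊ * d) (by linarith) (v - ⌊v / d⌋₊ * d) (by linarith) (by linarith)
  rw [show x + ⌊v / d⌋₊ * d + (v - ⌊v / d⌋₊ * d) = x + v by ring] at h3
  rw [abs_le] at *
  constructor <;> linarith

/-- The uniform convergence theorem for continuous slowly varying functions. -/
theorem RatioSlow.uniform {S : ℝ → ℝ} (hS : RatioSlow S) {X : ℝ} (hc : ContinuousOn S (Set.Ici X))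
    (h0 : ∀ s, X ≤ s → 0 < S s) (Λ : ℝ) {η : ℝ} (hη : 0 < η) :
    ∀ᶠ s in atTop, ∀ σ, s ≤ σ → σ ≤ Λ * s → |S σ / S s - 1| ≤ η := by
  -- The maximum with X makes h continuous on the whole line without changing it near infinity.
  let h : ℝ → ℝ := fun x => Real.log (S (max X (Real.exp x)))
  have hcont : Continuous h := by
    have : Continuous fun x => S (max X (Real.exp x)) :=
      hc.comp_continuous (by fun_prop) fun x => Set.mem_Ici.2 (le_max_left _ _)
    exact this.log fun x => (h0 _ (le_max_left _ _)).ne'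
  have hexp : ∀ᶠ x : ℝ in atTop, X ≤ Real.exp x :=
    Real.tendsto_exp_atTop.eventually (eventually_ge_atTop X)
  have hv : ∀ v : ℝ, Tendsto (fun x => h (x + v) - h x) atTop (𝓝 0) := by
    intro v
    have h1 := ((hS (Real.exp v) (Real.exp_pos v)).comp Real.tendsto_exp_atTop).log one_ne_zero
    rw [Real.log_one] at h1
    refine h1.congr' ?_
    filter_upwards [hexp, (tendsto_atTop_add_const_right atTop v tendsto_id).eventually hexp]
      with x h2 h3
    simp only [id] at h3
    have h4 : Real.exp v * Real.exp x = Real.exp (x + v) := by rw [Real.exp_add, mul_comm]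
    simp only [h, Function.comp, max_eq_right h2, max_eq_right h3, h4]
    rw [Real.log_div (h0 _ h3).ne' (h0 _ h2).ne']
  obtain ⟨δ, hδ, hexpδ⟩ := Metric.continuousAt_iff.1 (Real.continuous_exp.continuousAt (x := 0)) η hη
  have h5 := (Real.tendsto_log_atTop).eventually
    (uniform_add_of_continuous hcont hv (Real.log Λ) (half_pos hδ))
  filter_upwards [h5, eventually_ge_atTop X, eventually_gt_atTop 0] with s hs hX hs0 σ h1 h2
  have hσ : 0 < σ := hs0.trans_le h1
  have hΛ : 0 < Λ := by
    by_contra hcon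
    nlinarith
  have h6 := hs (Real.log σ - Real.log s)
    ⟨sub_nonneg.2 (Real.log_le_log hs0 h1), by
      have := Real.log_le_log hσ h2
      rw [Real.log_mul hΛ.ne' hs0.ne'] at this
      linarith⟩
  rw [add_sub_cancel] at h6
  simp only [h, Real.exp_log hσ, Real.exp_log hs0, max_eq_right hX, max_eq_right (hX.trans h1)] at h6
  have hSσ := h0 σ (hX.trans h1)
  have hSs := h0 s hX
  rw [← Real.log_div hSσ.ne' hSs.ne'] at h6
  have h7 := @hexpδ (Real.log (S σ / S s)) (by
    rw [Real.dist_eq, sub_zero]; linarith)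
  rw [Real.exp_log (div_pos hSσ hSs), Real.exp_zero, Real.dist_eq] at h7
  exact h7.le

/-- A contracting dyadic recursion forces convergence to zero. -/
theorem tendsto_zero_of_dyadic_recursion {ψ : ℝ → ℝ} {X : ℝ} (hX : 0 < X)
    (hψ : ContinuousOn ψ (Set.Ici X))
    (hrec : ∀ η : ℝ, 0 < η → ∀ᶠ s in atTop, |ψ (2 * s)| ≤ η + 3 / 4 * |ψ s|) :
    Tendsto ψ atTop (𝓝 0) := by
  rw [Metric.tendsto_atTop]
  intro e he
  -- The recursion with η = e/8 has fixed point 4η = e/2; the excess decays like (3/4)^n from its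
  -- bound on [Z, 2Z].
  obtain ⟨Y, hY⟩ := eventually_atTop.1 (hrec (e / 8) (by positivity))
  set Z := max X Y with hZ
  have hZ0 : 0 < Z := hX.trans_le (le_max_left _ _)
  have hZY : Y ≤ Z := le_max_right _ _
  have hZX : X ≤ Z := le_max_left _ _
  obtain ⟨B, hB⟩ := (isCompact_Icc (a := Z) (b := 2 * Z)).exists_bound_of_continuousOn
    (hψ.mono fun s hs => hZX.trans hs.1)
  have hB0 : 0 ≤ B := (norm_nonneg _).trans (hB Z ⟨le_rfl, by linarith⟩)
  have key : ∀ n : ℕ, ∀ s, 2 ^ n * Z ≤ s → s ≤ 2 ^ (n + 1) * Z →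
      |ψ s| ≤ e / 2 + (3 / 4) ^ n * B := by
    intro n
    induction n with
    | zero =>
      intro s h1 h2
      have := hB s ⟨by simpa using h1, by simpa using h2⟩
      rw [Real.norm_eq_abs] at this
      simp only [pow_zero, one_mul]; linarith
    | succ n ih =>
      intro s h1 h2
      have h3 := ih (s / 2) (by rw [pow_succ] at h1; linarith) (by
        rw [pow_succ] at h2; linarith)
      have h4 : Z ≤ s / 2 := by
        have : (1 : ℝ) ≤ 2 ^ n := one_le_pow₀ (by norm_num)
        rw [pow_succ] at h1
        nlinarith
      have h5 := hY (s / 2) (by linarith)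
      rw [mul_div_cancel₀ s two_ne_zero] at h5
      rw [pow_succ]
      linarith
  have hpow : Tendsto (fun n : ℕ => (3 / 4 : ℝ) ^ n * B) atTop (𝓝 0) := by
    simpa using (tendsto_pow_atTop_nhds_zero_of_lt_one (by norm_num : (0 : ℝ) ≤ 3 / 4)
      (by norm_num)).mul_const B
  obtain ⟨N, hN⟩ := eventually_atTop.1 (hpow.eventually (gt_mem_nhds (half_pos he)))
  refine ⟨2 ^ N * Z, fun s hs => ?_⟩
  have h1 : 1 ≤ s / Z := by
    rw [le_div_iff₀ hZ0]
    have : (1 : ℝ) ≤ 2 ^ N := one_le_pow₀ (by norm_num)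
    nlinarith
  obtain ⟨n, hn1, hn2⟩ := exists_nat_pow_near h1 (one_lt_two : (1 : ℝ) < 2)
  rw [le_div_iff₀ hZ0] at hn1
  rw [div_lt_iff₀ hZ0] at hn2
  have hNn : N ≤ n := by
    have : (2 : ℝ) ^ N < 2 ^ (n + 1) := lt_of_mul_lt_mul_right (hs.trans_lt hn2) hZ0.le
    have := (pow_lt_pow_iff_right₀ (one_lt_two : (1 : ℝ) < 2)).1 this
    omega
  rw [Real.dist_eq, sub_zero]
  have := key n s hn1 hn2.le
  have := hN n hNn
  linarith

/-- Karamata's theorem for continuous slowly varying functions: any primitive `F` of `S`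
satisfies `F(s) ∼ s S(s)`. -/
theorem RatioSlow.karamata {S F : ℝ → ℝ} (hS : RatioSlow S) {X : ℝ}
    (hc : ContinuousOn S (Set.Ici X)) (h0 : ∀ s, X ≤ s → 0 < S s)
    (hF : ∀ s, X ≤ s → HasDerivAt F (S s) s) :
    Tendsto (fun s => F s / (s * S s)) atTop (𝓝 1) := by
  suffices h : Tendsto (fun s => F s / (s * S s) - 1) atTop (𝓝 0) by
    simpa using h.add_const 1
  have hY : ∀ s, max X 1 ≤ s → X ≤ s ∧ 1 ≤ s := fun s hs => max_le_iff.1 hs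
  refine tendsto_zero_of_dyadic_recursion (X := max X 1) (by positivity) ?_ ?_
  · have hFc : ContinuousOn F (Set.Ici (max X 1)) := fun s hs =>
      (hF s (hY s hs).1).continuousAt.continuousWithinAt
    refine (hFc.div (continuousOn_id.mul (hc.mono fun s hs => (hY s hs).1)) ?_).sub continuousOn_const
    intro s hs
    have := h0 s (hY s hs).1
    have := (hY s hs).2
    exact (mul_pos (by simp only [id]; linarith) (h0 s (hY s hs).1)).ne'
  -- By the mean value theorem F(2s) = F(s) + s S(ξ), with S(ξ) and S(2s) close to S(s). So F/(sS) -
  -- 1 is roughly halved at each doubling, which also makes the constant of integration irrelevant.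
  -- The choice of e gives 2D ≥ 3/2 and error 3e/(2D) ≤ η/2.
  · intro η hη
    set e := min (η / 4) (1 / 4) with he
    have he0 : 0 < e := by positivity
    have he1 : e ≤ η / 4 := min_le_left _ _
    have he2 : e ≤ 1 / 4 := min_le_right _ _
    filter_upwards [hS.uniform hc h0 2 he0, eventually_ge_atTop (max X 1)] with s hs hsX
    obtain ⟨hsX, hs1⟩ := hY s hsX
    obtain ⟨ξ, hξ, hξ'⟩ := exists_hasDerivAt_eq_slope F S (by linarith : s < 2 * s)
      (fun z hz => (hF z (hsX.trans hz.1)).continuousAt.continuousWithinAt)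
      (fun z hz => hF z (hsX.trans hz.1.le))
    rw [show 2 * s - s = s by ring, eq_div_iff (by positivity)] at hξ'
    have a1 := hs ξ hξ.1.le hξ.2.le
    have a2 := hs (2 * s) (by linarith) le_rfl
    have p0 := h0 s hsX
    have p1 := h0 ξ (hsX.trans hξ.1.le)
    have p2 := h0 (2 * s) (by linarith)
    set A := S ξ / S s with hA
    set D := S (2 * s) / S s with hD
    have hAS : S ξ = A * S s := by rw [hA]; field_simp
    have hDS : S (2 * s) = D * S s := by rw [hD]; field_simp
    have hD0 : 0 < D := div_pos p2 p0
    rw [abs_le] at a1 a2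
    set φ := F s / (s * S s) with hφ
    have hFs : F s = φ * (s * S s) := by rw [hφ]; field_simp
    have e1 : F (2 * s) / (2 * s * S (2 * s)) - 1
        = ((A + 1 - 2 * D) + (φ - 1)) / (2 * D) := by
      have : F (2 * s) = F s + S ξ * s := by linarith
      rw [this, hFs, hAS, hDS]
      field_simp
      ring
    rw [e1, abs_div, abs_of_pos (by positivity : 0 < 2 * D), div_le_iff₀ (by positivity)]
    have b1 : |A + 1 - 2 * D| ≤ 3 * e := by rw [abs_le]; constructor <;> linarith
    have b2 := abs_add_le (A + 1 - 2 * D) (φ - 1)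
    have b3 := abs_nonneg (φ - 1)
    nlinarith

/-- If `s f'(s) / f(s) → 0`, then `log f` oscillates little over intervals `[s/K, K s]`. -/
theorem tendsto_ratio_of_logDeriv {f f' σ : ℝ → ℝ} {X K : ℝ} (hK : 1 ≤ K)
    (hf : ∀ s, X ≤ s → HasDerivAt f (f' s) s) (h0 : ∀ s, X ≤ s → 0 < f s)
    (h : Tendsto (fun s => s * f' s / f s) atTop (𝓝 0))
    (hσ1 : ∀ᶠ s in atTop, s ≤ K * σ s) (hσ2 : ∀ᶠ s in atTop, σ s ≤ K * s) :
    Tendsto (fun s => f (σ s) / f s) atTop (𝓝 1) := by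
  have hK0 : 0 < K := by linarith
  suffices hl : Tendsto (fun s => Real.log (f (σ s)) - Real.log (f s)) atTop (𝓝 0) by
    have h1 := (Real.continuous_exp.tendsto 0).comp hl
    rw [Real.exp_zero] at h1
    refine h1.congr' ?_
    filter_upwards [hσ1, eventually_ge_atTop X, eventually_ge_atTop (K * X)] with s h1 h2 h3
    have h4 : X ≤ σ s := le_of_mul_le_mul_left (h3.trans h1) hK0
    simp only [Function.comp]
    rw [Real.exp_sub, Real.exp_log (h0 _ h4), Real.exp_log (h0 _ h2)]
  rw [Metric.tendsto_atTop']
  intro e he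
  -- On [s/K, Ks] the derivative of log f is at most ηK/s, and |σ(s) - s| ≤ Ks, so log f changes by
  -- at most ηK² = e/2.
  have hη : 0 < e / (2 * K * K) := by positivity
  obtain ⟨Y, hY⟩ := eventually_atTop.1 (h.eventually (Metric.closedBall_mem_nhds 0 hη))
  have hev : ∀ᶠ s in atTop, dist (Real.log (f (σ s)) - Real.log (f s)) 0 < e := by
    filter_upwards [hσ1, hσ2, eventually_ge_atTop (K * X), eventually_ge_atTop (K * Y),
      eventually_gt_atTop 0] with s h1 h2 h3 h4 hs
    have hsK : s / K ≤ s := div_le_self hs.le hK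
    have hKs : s ≤ K * s := by nlinarith
    have hmem : ∀ z ∈ Set.Icc (s / K) (K * s), X ≤ z ∧ Y ≤ z ∧ 0 < z := fun z hz => by
      refine ⟨le_trans ?_ hz.1, le_trans ?_ hz.1, lt_of_lt_of_le (by positivity) hz.1⟩
      · rwa [le_div_iff₀ hK0, mul_comm]
      · rwa [le_div_iff₀ hK0, mul_comm]
    have hbd : ∀ z ∈ Set.Icc (s / K) (K * s), ‖f' z / f z‖ ≤ e / (2 * K * K) * (K / s) := by
      intro z hz
      obtain ⟨m1, m2, m3⟩ := hmem z hz
      have h5 := hY z m2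
      rw [Real.dist_eq, sub_zero, mul_div_assoc, abs_mul,
        abs_of_pos m3, mul_comm, ← le_div_iff₀ m3] at h5
      refine h5.trans ?_
      rw [div_eq_mul_inv _ z]
      refine mul_le_mul_of_nonneg_left ?_ hη.le
      have h6 := hz.1
      rw [div_le_iff₀ hK0] at h6
      rw [inv_le_comm₀ m3 (by positivity), inv_div, div_le_iff₀ hK0]
      exact h6
    have h7 := (convex_Icc (s / K) (K * s)).norm_image_sub_le_of_norm_hasDerivWithin_le
      (f := fun z => Real.log (f z)) (f' := fun z => f' z / f z)
      (fun z hz => ((hf z (hmem z hz).1).log (h0 z (hmem z hz).1).ne').hasDerivWithinAt) hbd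
      ⟨hsK, hKs⟩ (show σ s ∈ Set.Icc (s / K) (K * s) from
        ⟨by rwa [div_le_iff₀ hK0, mul_comm], h2⟩)
    rw [dist_zero_right]
    refine h7.trans_lt ?_
    have h8 : ‖σ s - s‖ ≤ K * s := by
      have : 0 ≤ σ s := by
        by_contra hcon
        nlinarith
      rw [Real.norm_eq_abs, abs_le]
      constructor <;> linarith
    calc e / (2 * K * K) * (K / s) * ‖σ s - s‖ ≤ e / (2 * K * K) * (K / s) * (K * s) := by gcongr
      _ = e / 2 := by field_simp
      _ < e := by linarith
  obtain ⟨N, hN⟩ := eventually_atTop.1 hev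
  exact ⟨N, fun n hn => hN n hn.le⟩

theorem ratioSlow_of_logDeriv {f f' : ℝ → ℝ} {X : ℝ}
    (hf : ∀ s, X ≤ s → HasDerivAt f (f' s) s) (h0 : ∀ s, X ≤ s → 0 < f s)
    (h : Tendsto (fun s => s * f' s / f s) atTop (𝓝 0)) : RatioSlow f := by
  intro c hc
  have hK : 1 ≤ max 1 (max c c⁻¹) := le_max_left _ _
  have hK1 : c ≤ max 1 (max c c⁻¹) := (le_max_left _ _).trans (le_max_right _ _)
  have hK2 : c⁻¹ ≤ max 1 (max c c⁻¹) := (le_max_right _ _).trans (le_max_right _ _)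
  refine tendsto_ratio_of_logDeriv hK hf h0 h ?_ ?_
  · filter_upwards [eventually_gt_atTop 0] with s hs
    calc s = c⁻¹ * (c * s) := by field_simp
      _ ≤ _ := by gcongr
  · filter_upwards [eventually_gt_atTop 0] with s hs
    gcongr

/-- If `u' > 0`, `s u'(s)` is slowly varying and `u → M`, then `s u'(s) = o(M - u(s))`. -/
theorem tendsto_deriv_div_remainder {u u' : ℝ → ℝ} {X M : ℝ} (hX : 0 < X)
    (hu : ∀ s, X ≤ s → HasDerivAt u (u' s) s) (h0 : ∀ s, X ≤ s → 0 < u' s)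
    (hc : ContinuousOn u' (Set.Ici X)) (hS : RatioSlow fun s => s * u' s)
    (hlt : ∀ s, X ≤ s → u s < M) :
    Tendsto (fun s => s * u' s / (M - u s)) atTop (𝓝 0) := by
  rw [Metric.tendsto_nhds]
  intro e he
  -- Cauchy's mean value theorem for u against log gives u(Λs) - u(s) = log Λ · ξu'(ξ) ≥ (4/e) ·
  -- su'(s)/2. As M - u(s) exceeds this increment, su'(s)/(M - u(s)) is below e/2.
  set Λ := Real.exp (4 / e) with hΛ
  have hΛ1 : 1 < Λ := Real.one_lt_exp_iff.2 (by positivity)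
  have hlog : Real.log Λ = 4 / e := Real.log_exp _
  filter_upwards [hS.uniform (continuousOn_id.mul hc)
    (fun s hs => mul_pos (hX.trans_le hs) (h0 s hs)) Λ (by norm_num : (0 : ℝ) < 1 / 2),
    eventually_ge_atTop X] with s hs hsX
  have hs0 : 0 < s := hX.trans_le hsX
  have hsΛ : s < Λ * s := by nlinarith
  obtain ⟨ξ, hξ, hξ'⟩ := exists_ratio_hasDerivAt_eq_ratio_slope u u' hsΛ
    (fun z hz => (hu z (hsX.trans hz.1)).continuousAt.continuousWithinAt)
    (fun z hz => hu z (hsX.trans hz.1.le)) Real.log (fun z => z⁻¹)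
    (fun z hz => (Real.continuousAt_log (hs0.trans_le hz.1).ne').continuousWithinAt)
    (fun z hz => Real.hasDerivAt_log (hs0.trans hz.1).ne')
  have hξ0 : 0 < ξ := hs0.trans hξ.1
  rw [Real.log_mul (by positivity) hs0.ne', hlog, add_sub_cancel_right] at hξ'
  have h1 : u (Λ * s) - u s = 4 / e * (ξ * u' ξ) := by
    have : (u (Λ * s) - u s) * ξ⁻¹ * ξ = 4 / e * u' ξ * ξ := by rw [hξ']
    rw [inv_mul_cancel_right₀ hξ0.ne'] at this
    rw [this]; ring
  have h2 := hs ξ hξ.1.le hξ.2.le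
  have hk : 0 < s * u' s := mul_pos hs0 (h0 s hsX)
  have h3 : s * u' s / 2 ≤ ξ * u' ξ := by
    have := (abs_le.1 h2).1
    have h4 : (1 / 2 : ℝ) ≤ ξ * u' ξ / (s * u' s) := by linarith
    rw [le_div_iff₀ hk] at h4
    linarith
  have h5 := hlt (Λ * s) (by linarith)
  have h6 : 4 / e * (s * u' s / 2) ≤ 4 / e * (ξ * u' ξ) := by gcongr
  have h7 : 0 < M - u s := sub_pos.2 (hlt s hsX)
  rw [Real.dist_eq, sub_zero, abs_of_pos (div_pos hk h7), div_lt_iff₀ h7]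
  have h8 : 2 * (s * u' s) ≤ e * (M - u s) := by
    have h9 : 4 / e * (s * u' s / 2) ≤ M - u s := by linarith
    calc 2 * (s * u' s) = e * (4 / e * (s * u' s / 2)) := by field_simp; ring
      _ ≤ _ := by gcongr
  linarith

/-! ### Asymptotics of the transformed delay system. -/

/-- The system `x' = u^(β-1)`, `u' = P Φ(x ∘ T)` on `[X, ∞)` obtained from the half-linear
equation by the change of variable `s = R_D(t)`, with the properties of its data. -/
structure DelaySystem (α β X K : ℝ) (x u P T κ : ℝ → ℝ) : Prop where
  one_lt : 1 < α
  conj : (β - 1) * (α - 1) = 1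
  X_pos : 0 < X
  K_ge : 1 ≤ K
  x_pos : ∀ s, X ≤ s → 0 < x s
  xT_pos : ∀ s, X ≤ s → 0 < x (T s)
  u_pos : ∀ s, X ≤ s → 0 < u s
  P_pos : ∀ s, X ≤ s → 0 < P s
  κ_pos : ∀ s, X ≤ s → 0 < κ s
  deriv_x : ∀ s, X ≤ s → HasDerivAt x (u s ^ (β - 1)) s
  deriv_u : ∀ s, X ≤ s → HasDerivAt u (P s * x (T s) ^ (α - 1)) s
  deriv_T : ∀ s, X ≤ s → HasDerivAt T (κ s) s
  cont_u' : ContinuousOn (fun s => P s * x (T s) ^ (α - 1)) (Set.Ici X)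
  cont_κ : ContinuousOn κ (Set.Ici X)
  T_le : ∀ s, X ≤ s → T s ≤ s
  le_T : ∀ s, X ≤ s → s ≤ K * T s
  κ_slow : RatioSlow κ
  P_slow : RatioSlow fun s => s ^ α * P s
  P_lim : Tendsto (fun s => s ^ α * P s) atTop (𝓝 0)

namespace DelaySystem

variable {α β X K : ℝ} {x u P T κ : ℝ → ℝ} (D : DelaySystem α β X K x u P T κ)
include D

theorem K_pos : 0 < K := zero_lt_one.trans_le D.K_ge

theorem α_pos : 0 < α - 1 := sub_pos.2 D.one_lt

theorem β_pos : 0 < β - 1 := by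
  have := D.conj
  have := D.α_pos
  by_contra h
  nlinarith

theorem pos {s : ℝ} (hs : X ≤ s) : 0 < s := D.X_pos.trans_le hs

theorem deriv_u_pos {s : ℝ} (hs : X ≤ s) : 0 < P s * x (T s) ^ (α - 1) :=
  mul_pos (D.P_pos s hs) (Real.rpow_pos_of_pos (D.xT_pos s hs) _)

theorem deriv_x_pos {s : ℝ} (hs : X ≤ s) : 0 < u s ^ (β - 1) :=
  Real.rpow_pos_of_pos (D.u_pos s hs) _

theorem cont_u : ContinuousOn u (Set.Ici X) := fun s hs =>
  (D.deriv_u s hs).continuousAt.continuousWithinAt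

theorem cont_x : ContinuousOn x (Set.Ici X) := fun s hs =>
  (D.deriv_x s hs).continuousAt.continuousWithinAt

theorem cont_x' : ContinuousOn (fun s => u s ^ (β - 1)) (Set.Ici X) :=
  D.cont_u.rpow_const fun s hs => Or.inl (D.u_pos s hs).ne'

theorem strictMono_u : StrictMonoOn u (Set.Ici X) := by
  refine strictMonoOn_of_deriv_pos (convex_Ici X) D.cont_u fun s hs => ?_
  rw [interior_Ici] at hs
  rw [(D.deriv_u s (le_of_lt hs)).deriv]
  exact D.deriv_u_pos (le_of_lt hs)

theorem strictMono_x : StrictMonoOn x (Set.Ici X) := by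
  refine strictMonoOn_of_deriv_pos (convex_Ici X) D.cont_x fun s hs => ?_
  rw [interior_Ici] at hs
  rw [(D.deriv_x s (le_of_lt hs)).deriv]
  exact D.deriv_x_pos (le_of_lt hs)

theorem tendsto_T : Tendsto T atTop atTop := by
  refine tendsto_atTop_mono' _ (f₁ := fun s => K⁻¹ * s) ?_
    (tendsto_const_mul_atTop' (inv_pos.2 D.K_pos))
  filter_upwards [eventually_ge_atTop X] with s hs
  rw [inv_mul_le_iff₀ D.K_pos]
  exact D.le_T s hs

theorem x'_rpow {s : ℝ} (hs : X ≤ s) : (u s ^ (β - 1)) ^ (α - 1) = u s := by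
  rw [← Real.rpow_mul (D.u_pos s hs).le, D.conj, Real.rpow_one]

/-- `x` is bounded by a multiple of `s x'`. -/
theorem exists_x_le : ∃ B, 0 < B ∧ ∀ s, X ≤ s → x s ≤ B * (s * u s ^ (β - 1)) := by
  -- The first summand absorbs x(X); the 1 covers x(s) - x(X) ≤ s x'(s), valid because x' increases.
  refine ⟨x X / (X * u X ^ (β - 1)) + 1, ?_, fun s hs => ?_⟩
  · have := D.x_pos X le_rfl
    have := D.deriv_x_pos le_rfl
    have := D.X_pos
    positivity
  have h0 := D.x_pos X le_rfl
  have h1 := D.deriv_x_pos le_rfl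
  have h2 := D.X_pos
  have hmono : ∀ z, X ≤ z → z ≤ s → u z ^ (β - 1) ≤ u s ^ (β - 1) := fun z hz hzs =>
    Real.rpow_le_rpow (D.u_pos z hz).le (D.strictMono_u.monotoneOn hz hs hzs) D.β_pos.le
  have h3 : x s - x X ≤ u s ^ (β - 1) * (s - X) := by
    refine (convex_Icc X s).image_sub_le_mul_sub_of_deriv_le (D.cont_x.mono Set.Icc_subset_Ici_self)
      (fun z hz => ?_) (fun z hz => ?_) X ⟨le_rfl, hs⟩ s ⟨hs, le_rfl⟩ hs
    · rw [interior_Icc] at hz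
      exact (D.deriv_x z hz.1.le).differentiableAt.differentiableWithinAt
    · rw [interior_Icc] at hz
      rw [(D.deriv_x z hz.1.le).deriv]
      exact hmono z hz.1.le hz.2.le
  have h4 : x X ≤ x X / (X * u X ^ (β - 1)) * (s * u s ^ (β - 1)) := by
    have h5 : X * u X ^ (β - 1) ≤ s * u s ^ (β - 1) := by
      have := hmono X le_rfl hs
      have := D.pos hs
      gcongr
    calc x X = x X / (X * u X ^ (β - 1)) * (X * u X ^ (β - 1)) := by field_simp
      _ ≤ _ := by gcongr
  have := D.deriv_x_pos hs
  nlinarith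

/-- Here T(s) ≤ s and x ≤ B s u^(β-1) give x(T s)^(α-1) ≤ (B s)^(α-1) u(s), since (β-1)(α-1) = 1;
the quotient is then dominated by B^(α-1) s^α P(s). -/
theorem tendsto_logDeriv_u :
    Tendsto (fun s => s * (P s * x (T s) ^ (α - 1)) / u s) atTop (𝓝 0) := by
  obtain ⟨B, hB, hx⟩ := D.exists_x_le
  have h := D.P_lim.const_mul (B ^ (α - 1))
  rw [mul_zero] at h
  refine squeeze_zero' ?_ ?_ h
  · filter_upwards [eventually_ge_atTop X] with s hs
    exact div_nonneg (mul_nonneg (D.pos hs).le (D.deriv_u_pos hs).le) (D.u_pos s hs).le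
  · filter_upwards [eventually_ge_atTop X, D.tendsto_T.eventually (eventually_ge_atTop X)]
      with s hs hT
    have hs0 := D.pos hs
    have h1 : x (T s) ^ (α - 1) ≤ B ^ (α - 1) * (s ^ (α - 1) * u s) := by
      have h2 : x (T s) ≤ B * (s * u s ^ (β - 1)) :=
        (D.strictMono_x.monotoneOn hT hs (D.T_le s hs)).trans (hx s hs)
      refine (Real.rpow_le_rpow (D.xT_pos s hs).le h2 D.α_pos.le).trans_eq ?_
      have := D.deriv_x_pos hs
      rw [Real.mul_rpow hB.le (by positivity), Real.mul_rpow hs0.le this.le, D.x'_rpow hs]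
    have hP := D.P_pos s hs
    rw [div_le_iff₀ (D.u_pos s hs)]
    calc s * (P s * x (T s) ^ (α - 1)) ≤ s * (P s * (B ^ (α - 1) * (s ^ (α - 1) * u s))) := by
          gcongr
      _ = B ^ (α - 1) * (s ^ α * P s) * u s := by
          rw [show s ^ α = s ^ (α - 1) * s by
            rw [← Real.rpow_add_one hs0.ne', sub_add_cancel]]
          ring

theorem ratioSlow_u : RatioSlow u :=
  ratioSlow_of_logDeriv D.deriv_u D.u_pos D.tendsto_logDeriv_u

theorem eventually_u_pos : ∀ᶠ s in atTop, 0 < u s :=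
  (eventually_ge_atTop X).mono D.u_pos

theorem ratioSlow_x' : RatioSlow fun s => u s ^ (β - 1) :=
  D.ratioSlow_u.rpow D.eventually_u_pos _

theorem tendsto_x_div : Tendsto (fun s => x s / (s * u s ^ (β - 1))) atTop (𝓝 1) :=
  D.ratioSlow_x'.karamata D.cont_x' (fun _ hs => D.deriv_x_pos hs) D.deriv_x

theorem tendsto_index : Tendsto (fun s => s * u s ^ (β - 1) / x s) atTop (𝓝 1) := by
  have := D.tendsto_x_div.inv₀ one_ne_zero
  simpa only [inv_div, inv_one] using this

theorem tendsto_T_div : Tendsto (fun s => T s / (s * κ s)) atTop (𝓝 1) :=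
  D.κ_slow.karamata D.cont_κ D.κ_pos D.deriv_T

/-- The delay moves the argument only within a bounded factor, s/K ≤ T(s) ≤ s, over which log u is
asymptotically constant. -/
theorem tendsto_u_T : Tendsto (fun s => u (T s) / u s) atTop (𝓝 1) := by
  refine tendsto_ratio_of_logDeriv D.K_ge D.deriv_u D.u_pos D.tendsto_logDeriv_u ?_ ?_
  · exact (eventually_ge_atTop X).mono D.le_T
  · filter_upwards [eventually_ge_atTop X] with s hs
    have := D.T_le s hs
    have := D.K_ge
    have := D.pos hs
    nlinarith

/-- `u'/u ∼ P (s κ)^(α-1)`. -/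
theorem tendsto_u'_div : Tendsto (fun s => P s * x (T s) ^ (α - 1) / u s /
    (P s * (κ s * s) ^ (α - 1))) atTop (𝓝 1) := by
  have h1 := ((D.tendsto_x_div.comp D.tendsto_T).mul D.tendsto_T_div).rpow_const
    (p := α - 1) (Or.inl (by norm_num))
  have h2 := h1.mul D.tendsto_u_T
  rw [mul_one, mul_one, Real.one_rpow] at h2
  refine h2.congr' ?_
  filter_upwards [eventually_ge_atTop X, D.tendsto_T.eventually (eventually_ge_atTop X)]
    with s hs hT
  have hs0 := D.pos hs
  have hT0 := D.pos hT
  have hκ := D.κ_pos s hs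
  have hP := D.P_pos s hs
  have hu := D.u_pos s hs
  have huT := D.u_pos _ hT
  have hx' := D.deriv_x_pos hT
  have hxT := D.xT_pos s hs
  have e1 : x (T s) / (T s * u (T s) ^ (β - 1)) * (T s / (s * κ s))
      = x (T s) / (u (T s) ^ (β - 1) * (κ s * s)) := by field_simp
  simp only [Function.comp]
  rw [e1, Real.div_rpow hxT.le (by positivity), Real.mul_rpow hx'.le (by positivity), D.x'_rpow hT]
  have : 0 < (κ s * s) ^ (α - 1) := by positivity
  field_simp

/-- `s P (s κ)^(α-1)` is slowly varying. -/
theorem ratioSlow_Q : RatioSlow fun s => s * (P s * (κ s * s) ^ (α - 1)) := by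
  have h1 := D.P_slow.mul (D.κ_slow.rpow ((eventually_ge_atTop X).mono D.κ_pos) (α - 1))
  refine h1.of_tendsto_div (l := 1) ?_ one_ne_zero ?_
  · filter_upwards [eventually_ge_atTop X] with s hs
    have := D.κ_pos s hs
    have := D.P_pos s hs
    have := D.pos hs
    positivity
  · refine tendsto_const_nhds.congr' ?_
    filter_upwards [eventually_ge_atTop X] with s hs
    have h1 := D.κ_pos s hs
    have h2 := D.P_pos s hs
    have hs0 := D.pos hs
    rw [Real.mul_rpow h1.le hs0.le, show s ^ α = s ^ (α - 1) * s by
            rw [← Real.rpow_add_one hs0.ne', sub_add_cancel]]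
    have : 0 < κ s ^ (α - 1) := by positivity
    have : 0 < s ^ (α - 1) := by positivity
    field_simp

theorem Q_pos {s : ℝ} (hs : X ≤ s) : 0 < P s * (κ s * s) ^ (α - 1) := by
  have := D.κ_pos s hs
  have := D.P_pos s hs
  have := D.pos hs
  positivity

/-- `(log (x/s))' ∼ (β-1) P (s κ)^(α-1)`. -/
theorem tendsto_logDeriv_x_div : Tendsto (fun s => (u s ^ (β - 1) / x s - 1 / s) /
    ((β - 1) * (P s * (κ s * s) ^ (α - 1)))) atTop (𝓝 1) := by
  -- S = s x'' is the derivative of s x' - x and is equivalent to (β-1) s Q x', where Q = P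
  -- (sκ)^(α-1). Karamata gives s x' - x ∼ s S; dividing by s x and using x ∼ s x' yields the claim.
  set S : ℝ → ℝ := fun s =>
    s * (P s * x (T s) ^ (α - 1) * (β - 1) * u s ^ (β - 1 - 1)) with hS
  have hβ := D.β_pos
  have hSQ : Tendsto (fun s => S s / (s * (P s * (κ s * s) ^ (α - 1)) * u s ^ (β - 1))) atTop
      (𝓝 (β - 1)) := by
    have h1 := D.tendsto_u'_div.const_mul (β - 1)
    rw [mul_one] at h1
    refine h1.congr' ?_
    filter_upwards [eventually_ge_atTop X] with s hs
    have h2 := D.Q_pos hs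
    have h3 := D.deriv_x_pos hs
    have h4 := D.u_pos s hs
    have h5 := D.pos hs
    simp only [hS]
    rw [Real.rpow_sub_one h4.ne']
    have : κ s * s ≠ 0 := (mul_pos (D.κ_pos s hs) h5).ne'
    have := D.P_pos s hs
    field_simp
  have hslow : RatioSlow S := by
    refine (D.ratioSlow_Q.mul D.ratioSlow_x').of_tendsto_div ?_ hβ.ne' hSQ
    filter_upwards [eventually_ge_atTop X] with s hs
    exact (mul_pos (mul_pos (D.pos hs) (D.Q_pos hs)) (D.deriv_x_pos hs)).ne'
  have hSpos : ∀ s, X ≤ s → 0 < S s := fun s hs => mul_pos (D.pos hs) <|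
    mul_pos (mul_pos (D.deriv_u_pos hs) hβ) (Real.rpow_pos_of_pos (D.u_pos s hs) _)
  have hScont : ContinuousOn S (Set.Ici X) :=
    continuousOn_id.mul ((D.cont_u'.mul continuousOn_const).mul
      (D.cont_u.rpow_const fun s hs => Or.inl (D.u_pos s hs).ne'))
  have hF : ∀ s, X ≤ s → HasDerivAt (fun s => s * u s ^ (β - 1) - x s) (S s) s := fun s hs => by
    have h1 := ((hasDerivAt_id s).mul ((D.deriv_u s hs).rpow_const (p := β - 1)
      (Or.inl (D.u_pos s hs).ne'))).sub (D.deriv_x s hs)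
    refine h1.congr_deriv ?_
    simp only [hS, id]
    ring
  have h1 := ((hslow.karamata hScont hSpos hF).mul hSQ).mul D.tendsto_index
  have h2 := h1.div_const (β - 1)
  rw [one_mul, mul_one, div_self hβ.ne'] at h2
  refine h2.congr' ?_
  filter_upwards [eventually_ge_atTop X] with s hs
  have a1 := D.Q_pos hs
  have a2 := D.deriv_x_pos hs
  have a3 := D.x_pos s hs
  have a4 := D.pos hs
  have a5 := hSpos s hs
  generalize P s * (κ s * s) ^ (α - 1) = Q at *
  generalize u s ^ (β - 1) = v at *
  generalize S s = S₀ at *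
  field_simp

/-! ### The case of a finite limit of u: the remainder M - u. -/

section Bounded

variable {M : ℝ} (hM : Tendsto u atTop (𝓝 M))
include hM

theorem u_lt {s : ℝ} (hs : X ≤ s) : u s < M := by
  have h1 : u s < u (s + 1) :=
    D.strictMono_u hs (Set.mem_Ici.2 (by linarith)) (by linarith)
  refine h1.trans_le (ge_of_tendsto hM ?_)
  filter_upwards [eventually_ge_atTop (s + 1)] with z hz
  exact D.strictMono_u.monotoneOn (Set.mem_Ici.2 (by linarith)) (Set.mem_Ici.2 (by linarith)) hz

/-- Once u → M > 0, the equivalence u' ∼ Q u becomes u' ∼ M Q, so s u' inherits slow variation from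
s Q. -/
theorem tendsto_su'_div_remainder :
    Tendsto (fun s => s * (P s * x (T s) ^ (α - 1)) / (M - u s)) atTop (𝓝 0) := by
  have hM0 : 0 < M := (D.u_pos X le_rfl).trans (D.u_lt hM le_rfl)
  refine tendsto_deriv_div_remainder D.X_pos D.deriv_u (fun s hs => D.deriv_u_pos hs) D.cont_u' ?_
    (fun s hs => D.u_lt hM hs)
  refine D.ratioSlow_Q.of_tendsto_div ?_ hM0.ne'
    (((D.tendsto_u'_div.mul hM).congr' ?_).trans_eq (by rw [one_mul]))
  · filter_upwards [eventually_ge_atTop X] with s hs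
    exact (mul_pos (D.pos hs) (D.Q_pos hs)).ne'
  · filter_upwards [eventually_ge_atTop X] with s hs
    have a1 := D.Q_pos hs
    have a2 := D.u_pos s hs
    have a4 := D.pos hs
    generalize P s * (κ s * s) ^ (α - 1) = Q at *
    field_simp

theorem ratioSlow_remainder : RatioSlow fun s => M - u s := by
  refine ratioSlow_of_logDeriv (X := X) (f' := fun s => -(P s * x (T s) ^ (α - 1)))
    (fun s hs => (D.deriv_u s hs).const_sub M) (fun s hs => sub_pos.2 (D.u_lt hM hs)) ?_
  have := (D.tendsto_su'_div_remainder hM).neg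
  rw [neg_zero] at this
  refine this.congr fun s => ?_
  ring

theorem tendsto_sQ_div_remainder :
    Tendsto (fun s => s * (P s * (κ s * s) ^ (α - 1)) / (M - u s)) atTop (𝓝 0) := by
  have hM0 : 0 < M := (D.u_pos X le_rfl).trans (D.u_lt hM le_rfl)
  have h := ((D.tendsto_su'_div_remainder hM).div (D.tendsto_u'_div) one_ne_zero).div hM hM0.ne'
  rw [zero_div, zero_div] at h
  refine h.congr' ?_
  filter_upwards [eventually_ge_atTop X] with s hs
  have a1 := D.Q_pos hs
  have a2 := D.u_pos s hs
  have a4 := D.deriv_u_pos hs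
  have a5 := sub_pos.2 (D.u_lt hM hs)
  simp only [Pi.div_apply]
  generalize P s * (κ s * s) ^ (α - 1) = Q at *
  generalize P s * x (T s) ^ (α - 1) = v at *
  field_simp

end Bounded

theorem tendsto_x : Tendsto x atTop atTop := by
  have h := (D.tendsto_x_div).eventually (lt_mem_nhds (by norm_num : (1 / 2 : ℝ) < 1))
  have h0 := D.deriv_x_pos le_rfl
  refine tendsto_atTop_mono' _ (f₁ := fun s => (u X ^ (β - 1) / 2) * s) ?_
    (tendsto_const_mul_atTop' (half_pos h0))
  filter_upwards [h, eventually_ge_atTop X] with s h1 hs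
  have h2 := D.pos hs
  have h3 := D.deriv_x_pos hs
  rw [lt_div_iff₀ (by positivity)] at h1
  have h4 : u X ^ (β - 1) ≤ u s ^ (β - 1) := Real.rpow_le_rpow (D.u_pos X le_rfl).le
    (D.strictMono_u.monotoneOn Set.self_mem_Ici hs hs) D.β_pos.le
  nlinarith

theorem normRegVar_x : NormRegVar x 1 := by
  have hX := D.X_pos
  classical
  -- The value 0 before X serves only global measurability; beyond X, ψ(s)/s is the derivative of
  -- log (x/s).
  set ψ : ℝ → ℝ := (Set.Ici X).piecewise (fun s => s * u s ^ (β - 1) / x s - 1) (fun _ => 0)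
    with hψ
  have hcont : ContinuousOn (fun s => s * u s ^ (β - 1) / x s - 1) (Set.Ici X) :=
    ((continuousOn_id.mul D.cont_x').div D.cont_x fun s hs => (D.x_pos s hs).ne').sub
      continuousOn_const
  have hψe : ∀ s, X ≤ s → ψ s = s * u s ^ (β - 1) / x s - 1 := fun s hs =>
    Set.piecewise_eq_of_mem _ _ _ hs
  have hdcont : ContinuousOn (fun s => ψ s / s) (Set.Ici X) :=
    (hcont.congr hψe).div continuousOn_id fun s hs => (D.pos hs).ne'
  refine ⟨X, x X / X, ψ, hX, div_pos (D.x_pos X le_rfl) hX,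
    hcont.measurable_piecewise continuousOn_const measurableSet_Ici, ?_, fun t ht => ?_⟩
  · have := D.tendsto_index.sub_const 1
    rw [sub_self] at this
    refine this.congr' ?_
    filter_upwards [eventually_ge_atTop X] with s hs
    rw [hψe s hs]
  have hint : IntervalIntegrable (fun s => ψ s / s) volume X t :=
    (hdcont.mono (by rw [Set.uIcc_of_le ht]; exact Set.Icc_subset_Ici_self)).intervalIntegrable
  refine ⟨hint, ?_⟩
  have h1 : ∫ s in X..t, ψ s / s = (Real.log (x t) - Real.log t) - (Real.log (x X) - Real.log X) := by
    refine intervalIntegral.integral_eq_sub_of_hasDerivAt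
      (f := fun s => Real.log (x s) - Real.log s) (fun s hs => ?_) hint
    rw [Set.uIcc_of_le ht] at hs
    have h2 := D.x_pos s hs.1
    have h3 := D.pos hs.1
    refine (((D.deriv_x s hs.1).log h2.ne').sub (Real.hasDerivAt_log h3.ne')).congr_deriv ?_
    rw [hψe s hs.1]
    field_simp
  have h2 := D.x_pos t ht
  have h3 := D.pos ht
  have h4 := D.x_pos X le_rfl
  rw [h1, Real.rpow_one, Real.exp_sub, Real.exp_sub, Real.exp_sub, Real.exp_log h2, Real.exp_log h3,
    Real.exp_log h4, Real.exp_log hX]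
  field_simp

end DelaySystem

/-! ### The change of variable s = R_D(t) and the transformed delay. -/

theorem Phi_of_pos {α v : ℝ} (hv : 0 < v) : Phi α v = v ^ (α - 1) := by
  rw [Phi, abs_of_pos hv, Real.sign_of_pos hv, mul_one]

/-- A positive continuous coefficient with `∫_a^∞ r^(1-β) = ∞`. -/
structure DivergentWeight (a β : ℝ) (r : ℝ → ℝ) : Prop where
  cont : ContinuousOn r (Set.Ici a)
  pos : ∀ t, a ≤ t → 0 < r t
  tendsto_RD : Tendsto (RD a β r) atTop atTop

namespace DivergentWeight

variable {a β : ℝ} {r : ℝ → ℝ} (W : DivergentWeight a β r)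
include W

theorem cont_rpow (e : ℝ) : ContinuousOn (fun t => r t ^ e) (Set.Ici a) :=
  W.cont.rpow_const fun t ht => Or.inl (W.pos t ht).ne'

omit W in
theorem RD_eq {t : ℝ} (ht : a ≤ t) : RD a β r t = ∫ s in a..t, r s ^ (1 - β) := by
  rw [RD, intervalIntegral.integral_of_le ht]

theorem intervalIntegrable {t : ℝ} (ht : a ≤ t) :
    IntervalIntegrable (fun s => r s ^ (1 - β)) volume a t :=
  ((W.cont_rpow _).mono (by rw [Set.uIcc_of_le ht]; exact Set.Icc_subset_Ici_self)).intervalIntegrable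

theorem hasDerivAt_RD {t : ℝ} (ht : a < t) : HasDerivAt (RD a β r) (r t ^ (1 - β)) t := by
  have hc : ContinuousOn (fun t => r t ^ (1 - β)) (Set.Ioi a) :=
    (W.cont_rpow _).mono Set.Ioi_subset_Ici_self
  have h := intervalIntegral.integral_hasDerivAt_right (W.intervalIntegrable ht.le)
    (hc.stronglyMeasurableAtFilter isOpen_Ioi t ht) (hc.continuousAt (Ioi_mem_nhds ht))
  refine h.congr_of_eventuallyEq ?_
  filter_upwards [Ioi_mem_nhds ht] with s hs using RD_eq (le_of_lt hs)

theorem cont_RD : ContinuousOn (RD a β r) (Set.Ici a) := by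
  intro t ht
  have h1 : ContinuousOn (fun s => ∫ z in a..s, r z ^ (1 - β)) (Set.uIcc a (t + 1)) := by
    refine intervalIntegral.continuousOn_primitive_interval ?_
    have : a ≤ t + 1 := by have := Set.mem_Ici.1 ht; linarith
    rw [Set.uIcc_of_le this, integrableOn_Icc_iff_integrableOn_Ioc]
    exact (intervalIntegrable_iff_integrableOn_Ioc_of_le this).1 (W.intervalIntegrable this)
  have hta : a ≤ t := ht
  rw [Set.uIcc_of_le (by linarith)] at h1
  have h2 : ContinuousOn (RD a β r) (Set.Icc a (t + 1)) := h1.congr fun s hs => RD_eq hs.1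
  refine (h2 t ⟨hta, by linarith⟩).mono_of_mem_nhdsWithin ?_
  rw [← Set.Ici_inter_Iic]
  exact inter_mem_nhdsWithin _ (Iic_mem_nhds (by linarith))

theorem strictMono_RD : StrictMonoOn (RD a β r) (Set.Ici a) := by
  refine strictMonoOn_of_deriv_pos (convex_Ici a) W.cont_RD fun t ht => ?_
  rw [interior_Ici] at ht
  rw [(W.hasDerivAt_RD ht).deriv]
  exact Real.rpow_pos_of_pos (W.pos t (le_of_lt ht)) _

omit W in
theorem RD_of_le {t : ℝ} (ht : t ≤ a) : RD a β r t = 0 := by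
  rw [RD, Set.Ioc_eq_empty (not_lt.2 ht)]
  simp

theorem RD_nonneg (t : ℝ) : 0 ≤ RD a β r t := by
  rcases le_total t a with h | h
  · rw [RD_of_le h]
  · rw [← RD_of_le (r := r) (β := β) (le_refl a)]
    exact W.strictMono_RD.monotoneOn Set.self_mem_Ici h h

theorem RD_pos {t : ℝ} (ht : a < t) : 0 < RD a β r t := by
  rw [← RD_of_le (r := r) (β := β) (le_refl a)]
  exact W.strictMono_RD Set.self_mem_Ici ht.le ht

theorem mem_image {s : ℝ} (hs : 0 ≤ s) : s ∈ RD a β r '' Set.Ici a := by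
  obtain ⟨t, ht, ht'⟩ := ((eventually_ge_atTop a).and
    (W.tendsto_RD.eventually (eventually_ge_atTop s))).exists
  refine Set.image_mono Set.Icc_subset_Ici_self
    (intermediate_value_Icc ht (W.cont_RD.mono Set.Icc_subset_Ici_self) ⟨?_, ht'⟩)
  rwa [RD_of_le le_rfl]

theorem le_RDinv {s : ℝ} (hs : 0 ≤ s) : a ≤ RDinv a β r s :=
  Function.invFunOn_mem (W.mem_image hs)

theorem RD_RDinv {s : ℝ} (hs : 0 ≤ s) : RD a β r (RDinv a β r s) = s :=
  Function.invFunOn_eq (W.mem_image hs)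

theorem RDinv_RD {t : ℝ} (ht : a ≤ t) : RDinv a β r (RD a β r t) = t :=
  W.strictMono_RD.injOn (W.le_RDinv (W.RD_nonneg t)) ht (W.RD_RDinv (W.RD_nonneg t))

theorem lt_RDinv {t s : ℝ} (ht : a ≤ t) (h : RD a β r t < s) : t < RDinv a β r s := by
  have hs : 0 ≤ s := (W.RD_nonneg t).trans h.le
  rw [← W.strictMono_RD.lt_iff_lt ht (W.le_RDinv hs), W.RD_RDinv hs]
  exact h

theorem a_lt_RDinv {s : ℝ} (hs : 0 < s) : a < RDinv a β r s :=
  W.lt_RDinv le_rfl (by rwa [RD_of_le le_rfl])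

theorem tendsto_RDinv : Tendsto (RDinv a β r) atTop atTop := by
  refine tendsto_atTop.2 fun b => ?_
  filter_upwards [eventually_gt_atTop (RD a β r (max a b))] with s hs
  exact (le_max_right a b).trans (W.lt_RDinv (le_max_left _ _) hs).le

theorem continuousAt_RDinv {s : ℝ} (hs : 0 < s) : ContinuousAt (RDinv a β r) s := by
  have hmono : StrictMonoOn (RDinv a β r) (Set.Ioi 0) := by
    intro s₁ h1 s₂ h2 h
    exact W.lt_RDinv (W.le_RDinv (le_of_lt h1)) (by rwa [W.RD_RDinv (le_of_lt h1)])
  refine hmono.continuousAt_of_image_mem_nhds (Ioi_mem_nhds hs) ?_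
  refine mem_of_superset (Ioi_mem_nhds (W.a_lt_RDinv hs)) fun t ht => ?_
  exact ⟨RD a β r t, W.RD_pos ht, W.RDinv_RD (le_of_lt ht)⟩

theorem rpow_neg_eq {t : ℝ} (ht : a ≤ t) : (r t ^ (1 - β))⁻¹ = r t ^ (β - 1) := by
  rw [← Real.rpow_neg (W.pos t ht).le, neg_sub]

theorem hasDerivAt_RDinv {s : ℝ} (hs : 0 < s) :
    HasDerivAt (RDinv a β r) (r (RDinv a β r s) ^ (β - 1)) s := by
  have h := W.a_lt_RDinv hs
  rw [← W.rpow_neg_eq h.le]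
  refine (W.hasDerivAt_RD h).of_local_left_inverse (W.continuousAt_RDinv hs)
    (Real.rpow_pos_of_pos (W.pos _ h.le) _).ne' ?_
  filter_upwards [Ioi_mem_nhds hs] with z hz using W.RD_RDinv (le_of_lt hz)

end DivergentWeight

/-- A `C¹` delay `τ ≤ id` with positive derivative on `[a, ∞)`. -/
structure SmoothDelay (a : ℝ) (τ : ℝ → ℝ) : Prop where
  contDiff : ContDiffOn ℝ 1 τ (Set.Ici a)
  deriv_pos : ∀ t, a ≤ t → 0 < derivWithin τ (Set.Ici a) t
  le : ∀ t, a ≤ t → τ t ≤ t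

namespace SmoothDelay

variable {a β : ℝ} {r τ : ℝ → ℝ} (W : DivergentWeight a β r) (Θ : SmoothDelay a τ)
include Θ

theorem cont : ContinuousOn τ (Set.Ici a) := Θ.contDiff.continuousOn

theorem cont_deriv : ContinuousOn (derivWithin τ (Set.Ici a)) (Set.Ici a) :=
  Θ.contDiff.continuousOn_derivWithin (uniqueDiffOn_Ici a) le_rfl

theorem hasDerivAt {t : ℝ} (ht : a < t) : HasDerivAt τ (derivWithin τ (Set.Ici a) t) t :=
  ((Θ.contDiff.differentiableOn one_ne_zero t ht.le).hasDerivWithinAt).hasDerivAt (Ici_mem_nhds ht)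

theorem strictMono : StrictMonoOn τ (Set.Ici a) := by
  refine strictMonoOn_of_deriv_pos (convex_Ici a) Θ.cont fun t ht => ?_
  rw [interior_Ici] at ht
  rw [(Θ.hasDerivAt ht).deriv]
  exact Θ.deriv_pos t (le_of_lt ht)

include W

theorem hasDerivAt_tauD {s : ℝ} (hs : 0 < s) (hτ : a < τ (RDinv a β r s)) :
    HasDerivAt (tauD a β r τ) (r (τ (RDinv a β r s)) ^ (1 - β) *
      (derivWithin τ (Set.Ici a) (RDinv a β r s) * r (RDinv a β r s) ^ (β - 1))) s :=
  (W.hasDerivAt_RD hτ).comp s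
    ((Θ.hasDerivAt (W.a_lt_RDinv hs)).comp s (W.hasDerivAt_RDinv hs))

theorem tauD_le {s : ℝ} (hs : 0 ≤ s) : tauD a β r τ s ≤ s := by
  have h := W.le_RDinv hs
  rcases le_total (τ (RDinv a β r s)) a with h1 | h1
  · rw [tauD, DivergentWeight.RD_of_le h1]; exact hs
  · conv_rhs => rw [← W.RD_RDinv hs]
    exact W.strictMono_RD.monotoneOn h1 h (Θ.le _ h)

-- `RD` is 0 to the left of a, so a positive value of τ_D certifies that τ has entered (a, ∞). The
-- bound s ≤ K τ_D(s) thus ensures that the delayed argument is admissible.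
omit W Θ in
theorem lt_of_tauD_pos {s : ℝ} (h : 0 < tauD a β r τ s) : a < τ (RDinv a β r s) := by
  by_contra hcon
  rw [tauD, DivergentWeight.RD_of_le (not_lt.1 hcon)] at h
  exact lt_irrefl _ h

/-- The explicit form of `q_D`. -/
theorem qD_eq {α : ℝ} {p : ℝ → ℝ} {t : ℝ} (ht : a < t) (hτ : a < τ t) :
    qD a α β r p τ t = (r (τ t) ^ (1 - β) * (derivWithin τ (Set.Ici a) t * r t ^ (β - 1)) *
      RD a β r t) ^ (α - 1) * p t := by
  have h := Θ.hasDerivAt_tauD W (W.RD_pos ht) (by rwa [W.RDinv_RD ht.le])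
  rw [W.RDinv_RD ht.le] at h
  rw [qD, h.deriv]

theorem qD_pos {α : ℝ} {p : ℝ → ℝ} (hp : ∀ t, a ≤ t → 0 < p t) {t : ℝ} (ht : a < t)
    (hτ : a < τ t) : 0 < qD a α β r p τ t := by
  rw [Θ.qD_eq W ht hτ]
  have := hp t ht.le
  have := W.RD_pos ht
  have := W.pos t ht.le
  have := W.pos _ hτ.le
  have := Θ.deriv_pos t ht.le
  positivity

theorem qD_intervalIntegrable {α : ℝ} (hα : 1 < α) {p : ℝ → ℝ} (hp : ContinuousOn p (Set.Ici a))
    {t₀ t : ℝ} (h0 : a ≤ t₀) (hτ : a ≤ τ t₀) (ht : t₀ ≤ t) :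
    IntervalIntegrable (qD a α β r p τ) volume t₀ t := by
  have hsub : Set.uIcc t₀ t ⊆ Set.Ici a := by
    rw [Set.uIcc_of_le ht]
    exact fun z hz => h0.trans hz.1
  have hlt : ∀ z, t₀ < z → a < τ z := fun z hz =>
    hτ.trans_lt (Θ.strictMono h0 (h0.trans hz.le) hz)
  have hmaps : Set.MapsTo τ (Set.uIcc t₀ t) (Set.Ici a) := by
    rw [Set.uIcc_of_le ht]
    exact fun z hz => hτ.trans (Θ.strictMono.monotoneOn h0 (h0.trans hz.1) hz.1)
  have hc : ContinuousOn (fun t => (r (τ t) ^ (1 - β) *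
      (derivWithin τ (Set.Ici a) t * r t ^ (β - 1)) * RD a β r t) ^ (α - 1) * p t)
      (Set.uIcc t₀ t) := by
    refine ContinuousOn.mul (ContinuousOn.rpow_const ?_ fun z _ => Or.inr (sub_pos.2 hα).le)
      (hp.mono hsub)
    exact ((((W.cont_rpow _).comp (Θ.cont.mono hsub) hmaps).mul
      ((Θ.cont_deriv.mono hsub).mul ((W.cont_rpow _).mono hsub))).mul (W.cont_RD.mono hsub))
  -- The formula is continuous up to t₀, whereas τ(t₀) may equal a and q_D involves a two-sided
  -- derivative; agreement on (t₀, t] suffices.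
  refine hc.intervalIntegrable.congr fun z hz => ?_
  rw [Set.uIoc_of_le ht] at hz
  exact (Θ.qD_eq W (h0.trans_lt hz.1) (hlt z hz.1)).symm

end SmoothDelay

/-! ### Solutions of the equation as solutions of the transformed system. -/

theorem IsIncSol.exists_hasDerivAt {a α β : ℝ} {r p τ y : ℝ → ℝ} (W : DivergentWeight a β r)
    (hαβ : (β - 1) * (α - 1) = 1) (hy : IsIncSol a α r p τ y) :
    ∃ T : ℝ, a < T ∧ ∀ t, T ≤ t → 0 < y t ∧ 0 < quasiDeriv α r y t ∧
      HasDerivAt y (quasiDeriv α r y t ^ (β - 1) * r t ^ (1 - β)) t ∧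
      HasDerivAt (quasiDeriv α r y) (p t * Phi α (y (τ t))) t ∧
      ContinuousAt (fun t => p t * Phi α (y (τ t))) t := by
  obtain ⟨⟨T₀, haT, hc1, hc2, hsol⟩, hinc⟩ := hy
  obtain ⟨T₁, hT₁⟩ := eventually_atTop.1 hinc
  refine ⟨max T₀ T₁ + 1, ?_, fun t ht => ?_⟩
  · have := le_max_left T₀ T₁
    linarith
  have h0 : T₀ < t := by
    have := le_max_left T₀ T₁
    linarith
  have h1 : T₁ ≤ t := by
    have := le_max_right T₀ T₁
    linarith
  have hr := W.pos t (haT.trans h0.le)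
  have hy' := hT₁ t h1
  have hq : quasiDeriv α r y t = r t * deriv y t ^ (α - 1) := by rw [quasiDeriv, Phi_of_pos hy']
  have hy'eq : quasiDeriv α r y t ^ (β - 1) * r t ^ (1 - β) = deriv y t := by
    rw [hq, Real.mul_rpow hr.le (Real.rpow_pos_of_pos hy' _).le, ← Real.rpow_mul hy'.le,
      mul_comm (α - 1), hαβ, Real.rpow_one, mul_right_comm, ← Real.rpow_add hr]
    simp
  refine ⟨(hsol t h0).1, ?_, ?_, ?_, ?_⟩
  · rw [hq]
    exact mul_pos hr (Real.rpow_pos_of_pos hy' _)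
  · rw [hy'eq]
    exact ((hc1.differentiableOn one_ne_zero).differentiableAt (Ioi_mem_nhds h0)).hasDerivAt
  · rw [← (hsol t h0).2]
    exact ((hc2.differentiableOn one_ne_zero).differentiableAt (Ioi_mem_nhds h0)).hasDerivAt
  · refine ((hc2.continuousOn_deriv_of_isOpen isOpen_Ioi le_rfl).continuousAt
      (Ioi_mem_nhds h0)).congr ?_
    filter_upwards [Ioi_mem_nhds h0] with z hz using (hsol z hz).2

theorem RegVar.ratioSlow_rpow_mul {f : ℝ → ℝ} {e : ℝ} (hf : RegVar f (-e)) :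
    RatioSlow fun s => s ^ e * f s := by
  intro c hc
  have h := (hf.2 c hc).const_mul (c ^ e)
  rw [← Real.rpow_add hc, add_neg_cancel, Real.rpow_zero] at h
  refine h.congr' ?_
  filter_upwards [eventually_gt_atTop 0] with s hs
  have := Real.rpow_pos_of_pos hs e
  rw [Real.mul_rpow hc.le hs.le]
  field_simp

theorem SlowVar.ratioSlow {f : ℝ → ℝ} (hf : SlowVar f) : RatioSlow f := fun c hc => by
  simpa using hf.2 c hc

theorem exists_delaySystem {a α β : ℝ} (hα : 1 < α) (hαβ : (β - 1) * (α - 1) = 1)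
    {r p τ y : ℝ → ℝ} (W : DivergentWeight a β r) (Θ : SmoothDelay a τ)
    (hp : ContinuousOn p (Set.Ici a)) (hp0 : ∀ t, a ≤ t → 0 < p t)
    (hpD : RegVar (pD a β r p) (-α))
    (hLpD : Tendsto (slowPart (pD a β r p) (-α)) atTop (𝓝 0))
    (hτD : ∃ K : ℝ, 0 < K ∧ ∀ᶠ s in atTop, s ≤ K * tauD a β r τ s)
    (hτD' : SlowVar (deriv (tauD a β r τ)))
    (hy : IsIncSol a α r p τ y) :
    ∃ X K : ℝ, DelaySystem α β X K (fun s => y (RDinv a β r s))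
      (fun s => quasiDeriv α r y (RDinv a β r s)) (pD a β r p) (tauD a β r τ)
      (deriv (tauD a β r τ)) := by
  obtain ⟨T, haT, hT⟩ := hy.exists_hasDerivAt W hαβ
  obtain ⟨K₀, hK₀, hK⟩ := hτD
  obtain ⟨X₁, hX₁⟩ := eventually_atTop.1 (hK.and ((eventually_gt_atTop 0).and
    (W.tendsto_RDinv.eventually (eventually_ge_atTop T))))
  set K := max 1 K₀
  have hK1 : 1 ≤ K := le_max_left _ _
  have hKK : K₀ ≤ K := le_max_right _ _
  set Y := max X₁ 1
  have hY1 : 1 ≤ Y := le_max_right _ _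
  have hYX : X₁ ≤ Y := le_max_left _ _
  have hYK : Y ≤ K * Y := by nlinarith
  have hs0 : ∀ s, Y ≤ s → 0 < s := fun s hs => by linarith
  have hle_T : ∀ s, Y ≤ s → s ≤ K * tauD a β r τ s := fun s hs => by
    have h := (hX₁ s (hYX.trans hs)).1
    have : 0 < K₀ * tauD a β r τ s := (hs0 s hs).trans_le h
    have := (pos_iff_pos_of_mul_pos this).1 hK₀
    nlinarith
  have hT0 : ∀ s, Y ≤ s → 0 < tauD a β r τ s := fun s hs => by
    have : 0 < K * tauD a β r τ s := (hs0 s hs).trans_le (hle_T s hs)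
    exact (pos_iff_pos_of_mul_pos this).1 (by linarith)
  have hτρ : ∀ s, Y ≤ s → a < τ (RDinv a β r s) := fun s hs =>
    SmoothDelay.lt_of_tauD_pos (hT0 s hs)
  have hTY : ∀ s, K * Y ≤ s → Y ≤ tauD a β r τ s := fun s hs =>
    le_of_mul_le_mul_left (hs.trans (hle_T s (hYK.trans hs))) (by linarith : 0 < K)
  have hx : ∀ s, Y ≤ s → HasDerivAt (fun s => y (RDinv a β r s))
      (quasiDeriv α r y (RDinv a β r s) ^ (β - 1)) s := fun s hs => by
    have h1 := (hX₁ s (hYX.trans hs)).2.2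
    have h2 := (hT _ h1).2.2.1.comp s (W.hasDerivAt_RDinv (hs0 s hs))
    refine h2.congr_deriv ?_
    have hr := W.pos _ (haT.le.trans h1)
    rw [mul_assoc, ← Real.rpow_add hr]
    simp
  have hxT : ∀ s, Y ≤ s → RDinv a β r (tauD a β r τ s) = τ (RDinv a β r s) := fun s hs =>
    W.RDinv_RD (hτρ s hs).le
  have hypos : ∀ s, Y ≤ s → 0 < y (RDinv a β r s) := fun s hs =>
    (hT _ (hX₁ s (hYX.trans hs)).2.2).1
  have hTd : ∀ s, Y ≤ s → HasDerivAt (tauD a β r τ) _ s := fun s hs =>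
    Θ.hasDerivAt_tauD W (hs0 s hs) (hτρ s hs)
  have hρc : ContinuousOn (RDinv a β r) (Set.Ici Y) := fun s hs =>
    (W.continuousAt_RDinv (hs0 s hs)).continuousWithinAt
  have hρm : Set.MapsTo (RDinv a β r) (Set.Ici Y) (Set.Ici a) := fun s hs =>
    W.le_RDinv (hs0 s hs).le
  have hκc : ContinuousOn (deriv (tauD a β r τ)) (Set.Ici Y) := by
    refine ContinuousOn.congr ?_ fun s hs => (hTd s hs).deriv
    refine ContinuousOn.mul ?_ ((Θ.cont_deriv.comp hρc hρm).mul ((W.cont_rpow _).comp hρc hρm))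
    exact (W.cont_rpow _).comp (Θ.cont.comp hρc hρm) fun s hs => (hτρ s hs).le
  have hsub : Set.Ici (K * Y) ⊆ Set.Ici Y := Set.Ici_subset_Ici.2 hYK
  -- Starting at KY rather than Y keeps T(s) ≥ Y, so everything known beyond Y also holds at the
  -- delayed argument.
  refine ⟨K * Y, K, hα, hαβ, by positivity, hK1, fun s hs => hypos s (hYK.trans hs),
    fun s hs => hypos _ (hTY s hs), fun s hs => (hT _ (hX₁ s (hYX.trans (hYK.trans hs))).2.2).2.1,
    fun s hs => ?_, fun s hs => ?_, fun s hs => hx s (hYK.trans hs), fun s hs => ?_,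
    fun s hs => ?_, ?_, hκc.mono hsub, fun s hs => Θ.tauD_le W (hs0 s (hYK.trans hs)).le,
    fun s hs => hle_T s (hYK.trans hs), hτD'.ratioSlow, hpD.ratioSlow_rpow_mul, ?_⟩
  · have h := hρm (hsub hs)
    exact mul_pos (hp0 _ h) (Real.rpow_pos_of_pos (W.pos _ h) _)
  · rw [(hTd s (hYK.trans hs)).deriv]
    have h := hρm (hsub hs)
    have := W.pos _ h
    have := W.pos _ (hτρ s (hYK.trans hs)).le
    have := Θ.deriv_pos _ h
    positivity
  · have hs' := hYK.trans hs
    have h1 := (hX₁ s (hYX.trans hs')).2.2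
    refine ((hT _ h1).2.2.2.1.comp s (W.hasDerivAt_RDinv (hs0 s hs'))).congr_deriv ?_
    have h2 := hypos _ (hTY s hs)
    simp only [hxT s hs'] at h2 ⊢
    rw [Phi_of_pos h2, pD]
    ring
  · exact (hTd s (hYK.trans hs)).differentiableAt.hasDerivAt
  · refine ContinuousOn.mul ?_ (ContinuousOn.rpow_const ?_ fun s _ => Or.inr (sub_pos.2 hα).le)
    · exact ((hp.comp hρc hρm).mul ((W.cont_rpow _).comp hρc hρm)).mono hsub
    · have hxc : ContinuousOn (fun s => y (RDinv a β r s)) (Set.Ici Y) := fun s hs =>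
        (hx s hs).continuousAt.continuousWithinAt
      exact hxc.comp (fun s hs => (hTd s (hYK.trans hs)).continuousAt.continuousWithinAt) hTY
  · refine hLpD.congr' ?_
    filter_upwards [eventually_gt_atTop 0] with s hs
    rw [slowPart, Real.rpow_neg hs.le, div_inv_eq_mul, mul_comm]

/-! ### Integrating asymptotic equivalences into exact formulas with a perturbation ε. -/

/-- If `h ∼ b q` then `h = (1 + ε) b q` beyond `T` with `ε → 0`, and `1 + ε` may be any constant
before `T`. -/
theorem exists_perturbation {b c T : ℝ} {q h : ℝ → ℝ} (hb : b ≠ 0) (hq : ∀ t, T < t → q t ≠ 0)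
    (hlim : Tendsto (fun t => h t / (b * q t)) atTop (𝓝 1)) :
    ∃ ε : ℝ → ℝ, Tendsto ε atTop (𝓝 0) ∧ (∀ t, t ≤ T → (1 + ε t) * b * q t = c * (b * q t)) ∧
      ∀ t, T < t → (1 + ε t) * b * q t = h t := by
  classical
  refine ⟨fun t => if t ≤ T then c - 1 else h t / (b * q t) - 1, ?_, fun t ht => ?_, fun t ht => ?_⟩
  · have h1 := hlim.sub_const 1
    rw [sub_self] at h1
    refine h1.congr' ?_
    filter_upwards [eventually_gt_atTop T] with t ht
    rw [if_neg (not_le.2 ht)]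
  · simp only [if_pos ht]
    ring
  · simp only [if_neg (not_le.2 ht)]
    have := hq t ht
    field_simp
    ring

theorem tendsto_atTop_of_deriv_equiv {g g' q : ℝ → ℝ} {t₀ : ℝ}
    (hg : ∀ᶠ t in atTop, HasDerivAt g (g' t) t) (hq : ∀ᶠ t in atTop, 0 < q t)
    (hqi : ∀ t, t₀ ≤ t → IntervalIntegrable q volume t₀ t)
    (hgc : ∀ᶠ t in atTop, ContinuousAt g' t)
    (h : Tendsto (fun t => g' t / q t) atTop (𝓝 1))
    (hdiv : Tendsto (fun t => ∫ s in t₀..t, q s) atTop atTop) : Tendsto g atTop atTop := by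
  obtain ⟨T, hT⟩ := eventually_atTop.1 (hg.and (hq.and (hgc.and
    ((h.eventually (lt_mem_nhds (by norm_num : (1 / 2 : ℝ) < 1))).and (eventually_ge_atTop t₀)))))
  have hlow : Tendsto (fun t => g T - 1 / 2 * (∫ s in t₀..T, q s) + 1 / 2 * ∫ s in t₀..t, q s)
      atTop atTop := tendsto_atTop_add_const_left _ _ (hdiv.const_mul_atTop (by norm_num))
  refine tendsto_atTop_mono' _ ?_ hlow
  filter_upwards [eventually_ge_atTop T] with t ht
  have hT0 := (hT T le_rfl).2.2.2.2
  have hqi' : IntervalIntegrable q volume T t := (hqi T hT0).symm.trans (hqi t (hT0.trans ht))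
  have hgi : IntervalIntegrable g' volume T t := by
    refine ContinuousOn.intervalIntegrable fun s hs => ?_
    rw [Set.uIcc_of_le ht] at hs
    exact (hT s hs.1).2.2.1.continuousWithinAt
  have h1 : ∫ s in T..t, g' s = g t - g T :=
    intervalIntegral.integral_eq_sub_of_hasDerivAt (fun s hs => by
      rw [Set.uIcc_of_le ht] at hs
      exact (hT s hs.1).1) hgi
  have h2 : ∫ s in T..t, 1 / 2 * q s ≤ ∫ s in T..t, g' s := by
    refine intervalIntegral.integral_mono_on ht (hqi'.const_mul _) hgi fun s hs => ?_
    obtain ⟨-, h3, -, h4, -⟩ := hT s hs.1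
    rw [lt_div_iff₀ h3] at h4
    exact h4.le
  rw [intervalIntegral.integral_const_mul] at h2
  have h3 := intervalIntegral.integral_add_adjacent_intervals (hqi T hT0) hqi'
  linarith

/-- Only the behaviour of ε at infinity is prescribed, so on [t₀, T] it can be a constant chosen to
make the integral there equal G(T). This is possible because q has positive integral, and it absorbs
the multiplicative constant in the formula for y. -/
theorem exists_exp_representation {b t₀ T : ℝ} {q G g : ℝ → ℝ} (hb : b ≠ 0) (hT : t₀ < T)
    (hqi : ∀ t, t₀ ≤ t → IntervalIntegrable q volume t₀ t) (hq : ∀ t, t₀ < t → 0 < q t)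
    (hG : ∀ t, T ≤ t → HasDerivAt G (g t) t) (hgc : ∀ t, T ≤ t → ContinuousAt g t)
    (hlim : Tendsto (fun t => g t / (b * q t)) atTop (𝓝 1)) :
    ∃ ε : ℝ → ℝ, Tendsto ε atTop (𝓝 0) ∧
      (∀ t, t₀ ≤ t → IntervalIntegrable (fun s => (1 + ε s) * b * q s) volume t₀ t) ∧
      ∀ t, T ≤ t → ∫ s in t₀..t, (1 + ε s) * b * q s = G t := by
  have hI : 0 < ∫ s in t₀..T, q s :=
    intervalIntegral.intervalIntegral_pos_of_pos_on (hqi T hT.le) (fun s hs => hq s hs.1) hT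
  obtain ⟨ε, hε, hε1, hε2⟩ := exists_perturbation (c := G T / (b * ∫ s in t₀..T, q s)) hb
    (fun t ht => (hq t (hT.trans ht)).ne') hlim
  have hle : ∀ t, t₀ ≤ t → t ≤ T →
      IntervalIntegrable (fun s => (1 + ε s) * b * q s) volume t₀ t := by
    intro t ht htT
    refine (((hqi t ht).const_mul b).const_mul _).congr fun s hs => (hε1 s ?_).symm
    rw [Set.uIoc_of_le ht] at hs
    exact hs.2.trans htT
  have hgi : ∀ t, T ≤ t → IntervalIntegrable g volume T t := by
    intro t ht
    refine ContinuousOn.intervalIntegrable fun s hs => ?_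
    rw [Set.uIcc_of_le ht] at hs
    exact (hgc s hs.1).continuousWithinAt
  have hge : ∀ t, T ≤ t → IntervalIntegrable (fun s => (1 + ε s) * b * q s) volume T t := by
    intro t ht
    refine (hgi t ht).congr fun s hs => (hε2 s ?_).symm
    rw [Set.uIoc_of_le ht] at hs
    exact hs.1
  refine ⟨ε, hε, fun t ht => ?_, fun t ht => ?_⟩
  · rcases le_total t T with h | h
    · exact hle t ht h
    · exact (hle T hT.le le_rfl).trans (hge t h)
  · have h1 : ∫ s in t₀..T, (1 + ε s) * b * q s = G T := by
      rw [intervalIntegral.integral_of_le hT.le, setIntegral_congr_fun measurableSet_Ioc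
        (fun s hs => hε1 s hs.2), ← intervalIntegral.integral_of_le hT.le,
        intervalIntegral.integral_const_mul, intervalIntegral.integral_const_mul]
      field_simp
    have h2 : ∫ s in T..t, (1 + ε s) * b * q s = G t - G T := by
      rw [intervalIntegral.integral_of_le ht, setIntegral_congr_fun measurableSet_Ioc
        (fun s hs => hε2 s hs.1), ← intervalIntegral.integral_of_le ht]
      refine intervalIntegral.integral_eq_sub_of_hasDerivAt (fun s hs => hG s ?_) (hgi t ht)
      rw [Set.uIcc_of_le ht] at hs
      exact hs.1
    rw [← intervalIntegral.integral_add_adjacent_intervals (hle T hT.le le_rfl) (hge t ht), h1, h2]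
    ring

theorem integrableOn_of_equiv {b t₀ T : ℝ} {q g : ℝ → ℝ} (hqi : IntegrableOn q (Set.Ioi t₀))
    (hgc : ∀ t, T ≤ t → ContinuousAt g t)
    (hlim : Tendsto (fun t => g t / (b * q t)) atTop (𝓝 1)) : IntegrableOn g (Set.Ioi T) := by
  have hO : g =O[atTop] fun t => b * q t := by
    refine Asymptotics.isBigO_of_div_tendsto_nhds ?_ 1 hlim
    -- A zero denominator would give the quotient its default value 0, and 1 - 0 stays away from 0;
    -- the limit 1 must exclude that value.
    filter_upwards [hlim.eventually_ne one_ne_zero] with t ht h0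
    exact absurd (by rw [h0, div_zero]) ht
  have h := LocallyIntegrableOn.integrableOn_of_isBigO_atTop (a := T)
    (ContinuousOn.locallyIntegrableOn (fun t ht => (hgc t ht).continuousWithinAt)
      measurableSet_Ici) hO ⟨Set.Ioi t₀, Ioi_mem_atTop t₀, hqi.const_mul b⟩
  exact h.mono_set Set.Ioi_subset_Ici_self

theorem exists_tail_representation {b t₀ T L : ℝ} {q G g : ℝ → ℝ} (hb : b ≠ 0) (hT : t₀ < T)
    (hqi : IntegrableOn q (Set.Ioi t₀)) (hq : ∀ t, t₀ < t → 0 < q t)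
    (hG : ∀ t, T ≤ t → HasDerivAt G (g t) t) (hgc : ∀ t, T ≤ t → ContinuousAt g t)
    (hlim : Tendsto (fun t => g t / (b * q t)) atTop (𝓝 1)) (hL : Tendsto G atTop (𝓝 L)) :
    ∃ ε : ℝ → ℝ, Tendsto ε atTop (𝓝 0) ∧
      IntegrableOn (fun s => (1 + ε s) * b * q s) (Set.Ioi t₀) ∧
      ∀ t, T ≤ t → ∫ s in Set.Ioi t, (1 + ε s) * b * q s = L - G t := by
  obtain ⟨ε, hε, hε1, hε2⟩ := exists_perturbation (c := 1) hb
    (fun t ht => (hq t (hT.trans ht)).ne') hlim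
  have hgi := integrableOn_of_equiv hqi hgc hlim
  refine ⟨ε, hε, ?_, fun t ht => ?_⟩
  · rw [← Set.Ioc_union_Ioi_eq_Ioi hT.le]
    refine IntegrableOn.union ?_ ?_
    · exact IntegrableOn.congr_fun
        (((hqi.mono_set Set.Ioc_subset_Ioi_self).const_mul b).const_mul 1)
        (fun s hs => (hε1 s hs.2).symm) measurableSet_Ioc
    · exact hgi.congr_fun (fun s hs => (hε2 s hs).symm) measurableSet_Ioi
  · rw [setIntegral_congr_fun measurableSet_Ioi (fun s hs => hε2 s (lt_of_le_of_lt ht hs))]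
    exact integral_Ioi_of_hasDerivAt_of_tendsto (hG t ht).continuousAt.continuousWithinAt
      (fun s hs => hG s (ht.trans (le_of_lt hs))) (hgi.mono_set (Set.Ioi_subset_Ioi ht)) hL

/-! ### Back to the variable t: the divergent and the convergent case. -/

/-- Eventual regularity of a solution, and the asymptotic forms of `(log y^[1])'` and of
`(log (y / R_D))'`. -/
theorem exists_tail {a α β : ℝ} (hαβ : (β - 1) * (α - 1) = 1)
    {r p τ y : ℝ → ℝ} (W : DivergentWeight a β r) (Θ : SmoothDelay a τ) {X K : ℝ}
    (D : DelaySystem α β X K (fun s => y (RDinv a β r s))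
      (fun s => quasiDeriv α r y (RDinv a β r s)) (pD a β r p) (tauD a β r τ)
      (deriv (tauD a β r τ)))
    (hy : IsIncSol a α r p τ y) {t₀ : ℝ} (h0 : a ≤ t₀) (hτ0 : a ≤ τ t₀) :
    ∃ T : ℝ, t₀ < T ∧ (∀ t, T ≤ t → 0 < y t ∧ 0 < quasiDeriv α r y t ∧
      HasDerivAt y (quasiDeriv α r y t ^ (β - 1) * r t ^ (1 - β)) t ∧
      HasDerivAt (quasiDeriv α r y) (p t * Phi α (y (τ t))) t ∧
      ContinuousAt (fun t => p t * Phi α (y (τ t))) t) ∧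
      Tendsto (fun t => p t * Phi α (y (τ t)) / quasiDeriv α r y t / qD a α β r p τ t)
        atTop (𝓝 1) ∧
      Tendsto (fun t => (quasiDeriv α r y t ^ (β - 1) * r t ^ (1 - β) / y t -
        r t ^ (1 - β) / RD a β r t) / ((β - 1) * qD a α β r p τ t)) atTop (𝓝 1) := by
  obtain ⟨T, haT, hT⟩ := hy.exists_hasDerivAt W hαβ
  have hQ : ∀ t, a < t → pD a β r p (RD a β r t) *
      (deriv (tauD a β r τ) (RD a β r t) * RD a β r t) ^ (α - 1) =
      qD a α β r p τ t * r t ^ (β - 1) := fun t ht => by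
    rw [pD, W.RDinv_RD ht.le, qD]
    ring
  refine ⟨max T (t₀ + 1), by simp, fun t ht => hT t ((le_max_left _ _).trans ht), ?_, ?_⟩
  · refine (D.tendsto_u'_div.comp W.tendsto_RD).congr' ?_
    filter_upwards [eventually_gt_atTop t₀, W.tendsto_RD.eventually (eventually_ge_atTop X)]
      with t ht hX
    have hat : a < t := h0.trans_lt ht
    have hτ : a < τ t := hτ0.trans_lt (Θ.strictMono h0 hat.le ht)
    have h2 := D.xT_pos _ hX
    have h3 := Real.rpow_pos_of_pos (W.pos t hat.le) (β - 1)
    have h4 : tauD a β r τ (RD a β r t) = RD a β r (τ t) := by rw [tauD, W.RDinv_RD hat.le]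
    simp only [Function.comp, h4, W.RDinv_RD hτ.le] at h2 ⊢
    rw [hQ t hat, pD, W.RDinv_RD hat.le, Phi_of_pos h2]
    field_simp
  · refine (D.tendsto_logDeriv_x_div.comp W.tendsto_RD).congr' ?_
    filter_upwards [eventually_gt_atTop t₀] with t ht
    have hat : a < t := h0.trans_lt ht
    have hr := W.pos t hat.le
    have h3 := Real.rpow_pos_of_pos hr (β - 1)
    simp only [Function.comp]
    rw [hQ t hat, W.RDinv_RD hat.le, ← W.rpow_neg_eq hat.le]
    have h4 := Real.rpow_pos_of_pos hr (1 - β)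
    field_simp

/-- Solutions in the divergent case. -/
theorem infInf_of_divergent {a α β : ℝ} (hαβ : (β - 1) * (α - 1) = 1)
    {r p τ y : ℝ → ℝ} (W : DivergentWeight a β r) (Θ : SmoothDelay a τ) {X K : ℝ}
    (D : DelaySystem α β X K (fun s => y (RDinv a β r s))
      (fun s => quasiDeriv α r y (RDinv a β r s)) (pD a β r p) (tauD a β r τ)
      (deriv (tauD a β r τ)))
    (hp0 : ∀ t, a ≤ t → 0 < p t)
    (hy : IsIncSol a α r p τ y) {t₀ : ℝ} (h0 : a ≤ t₀) (hτ0 : a ≤ τ t₀)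
    (hqi : ∀ t, t₀ ≤ t → IntervalIntegrable (qD a α β r p τ) volume t₀ t)
    (hdiv : Tendsto (fun t => ∫ s in t₀..t, qD a α β r p τ s) atTop atTop) :
    Tendsto (quasiDeriv α r y) atTop atTop ∧ ∃ ε : ℝ → ℝ, Tendsto ε atTop (𝓝 0) ∧
      (∀ t, t₀ ≤ t →
        IntervalIntegrable (fun s => (1 + ε s) * (β - 1) * qD a α β r p τ s) volume t₀ t) ∧
      ∀ᶠ t in atTop, y t = RD a β r t *
        Real.exp (∫ s in t₀..t, (1 + ε s) * (β - 1) * qD a α β r p τ s) := by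
  obtain ⟨T, hT0, hT, hE1, hE2⟩ := exists_tail hαβ W Θ D hy h0 hτ0
  have hat : ∀ t, t₀ < t → a < t := fun t ht => h0.trans_lt ht
  have hq : ∀ t, t₀ < t → 0 < qD a α β r p τ t := fun t ht =>
    Θ.qD_pos W hp0 (hat t ht) (hτ0.trans_lt (Θ.strictMono h0 (hat t ht).le ht))
  have hTt : ∀ t, T ≤ t → t₀ < t := fun t ht => hT0.trans_le ht
  constructor
  · have hlog : Tendsto (fun t => Real.log (quasiDeriv α r y t)) atTop atTop := by
      refine tendsto_atTop_of_deriv_equiv (t₀ := t₀)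
        (g' := fun t => p t * Phi α (y (τ t)) / quasiDeriv α r y t) ?_
        ((eventually_gt_atTop t₀).mono hq) hqi ?_ hE1 hdiv
      · filter_upwards [eventually_ge_atTop T] with t ht
        exact (hT t ht).2.2.2.1.log (hT t ht).2.1.ne'
      · filter_upwards [eventually_ge_atTop T] with t ht
        exact (hT t ht).2.2.2.2.div (hT t ht).2.2.2.1.continuousAt (hT t ht).2.1.ne'
    refine (Real.tendsto_exp_atTop.comp hlog).congr' ?_
    filter_upwards [eventually_ge_atTop T] with t ht
    exact Real.exp_log (hT t ht).2.1
  · have hr : ∀ t, T ≤ t → ContinuousAt (fun t => r t ^ (1 - β)) t := fun t ht =>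
      (W.cont_rpow _).continuousAt (Ici_mem_nhds (hat t (hTt t ht)))
    obtain ⟨ε, hε, hεi, hε2⟩ := exists_exp_representation
      (G := fun t => Real.log (y t) - Real.log (RD a β r t)) D.β_pos.ne' hT0 hqi hq
      (fun t ht => ((hT t ht).2.2.1.log (hT t ht).1.ne').sub
        ((W.hasDerivAt_RD (hat t (hTt t ht))).log (W.RD_pos (hat t (hTt t ht))).ne'))
      (fun t ht => ((((hT t ht).2.2.2.1.continuousAt.rpow_const (Or.inl (hT t ht).2.1.ne')).mul
        (hr t ht)).div (hT t ht).2.2.1.continuousAt (hT t ht).1.ne').sub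
          ((hr t ht).div (W.hasDerivAt_RD (hat t (hTt t ht))).continuousAt
            (W.RD_pos (hat t (hTt t ht))).ne')) hE2
    refine ⟨ε, hε, hεi, ?_⟩
    filter_upwards [eventually_ge_atTop T] with t ht
    have hR := W.RD_pos (hat t (hTt t ht))
    rw [hε2 t ht, Real.exp_sub, Real.exp_log (hT t ht).1, Real.exp_log hR]
    field_simp

/-- Solutions in the convergent case. -/
theorem infB_of_convergent {a α β : ℝ} (hαβ : (β - 1) * (α - 1) = 1)
    {r p τ y : ℝ → ℝ} (W : DivergentWeight a β r) (Θ : SmoothDelay a τ) {X K : ℝ}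
    (D : DelaySystem α β X K (fun s => y (RDinv a β r s))
      (fun s => quasiDeriv α r y (RDinv a β r s)) (pD a β r p) (tauD a β r τ)
      (deriv (tauD a β r τ)))
    (hp0 : ∀ t, a ≤ t → 0 < p t)
    (hy : IsIncSol a α r p τ y) {t₀ : ℝ} (h0 : a ≤ t₀) (hτ0 : a ≤ τ t₀)
    (hqi : IntegrableOn (qD a α β r p τ) (Set.Ioi t₀)) :
    ∃ M : ℝ, 0 < M ∧ Tendsto (quasiDeriv α r y) atTop (𝓝 M) ∧
      ∃ A : ℝ, ∃ ε : ℝ → ℝ, Tendsto ε atTop (𝓝 0) ∧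
        IntegrableOn (fun u => (1 + ε u) * (β - 1) * qD a α β r p τ u) (Set.Ioi t₀) ∧
        ∀ᶠ t in atTop, y t = A + ∫ s in t₀..t, M ^ (β - 1) * r s ^ (1 - β) *
          Real.exp (-∫ u in Set.Ioi s, (1 + ε u) * (β - 1) * qD a α β r p τ u) := by
  obtain ⟨T, hT0, hT, hE1, -⟩ := exists_tail hαβ W Θ D hy h0 hτ0
  have hat : ∀ t, t₀ < t → a < t := fun t ht => h0.trans_lt ht
  have hq : ∀ t, t₀ < t → 0 < qD a α β r p τ t := fun t ht =>
    Θ.qD_pos W hp0 (hat t ht) (hτ0.trans_lt (Θ.strictMono h0 (hat t ht).le ht))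
  have hTt : ∀ t, T ≤ t → t₀ < t := fun t ht => hT0.trans_le ht
  have hβ := D.β_pos
  set v := quasiDeriv α r y with hv
  set g : ℝ → ℝ := fun t => (β - 1) * (p t * Phi α (y (τ t)) / v t) with hg
  have hG : ∀ t, T ≤ t → HasDerivAt (fun t => (β - 1) * Real.log (v t)) (g t) t := fun t ht =>
    ((hT t ht).2.2.2.1.log (hT t ht).2.1.ne').const_mul _
  have hgc : ∀ t, T ≤ t → ContinuousAt g t := fun t ht =>
    ((hT t ht).2.2.2.2.div (hT t ht).2.2.2.1.continuousAt (hT t ht).2.1.ne').const_mul _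
  have hglim : Tendsto (fun t => g t / ((β - 1) * qD a α β r p τ t)) atTop (𝓝 1) :=
    hE1.congr fun t => by rw [hg, mul_div_mul_left _ _ hβ.ne']
  have hL := tendsto_limUnder_of_hasDerivAt_of_integrableOn_Ioi
    (fun t ht => hG t (le_of_lt ht)) (integrableOn_of_equiv hqi hgc hglim)
  set L := limUnder atTop fun t => (β - 1) * Real.log (v t)
  -- L is the limit of (β-1) log y^[1], which exists because the derivative is integrable; M is the
  -- corresponding limit of y^[1].
  set M := Real.exp (L / (β - 1)) with hM
  have hM0 : 0 < M := Real.exp_pos _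
  have hvM : Tendsto v atTop (𝓝 M) := by
    refine ((Real.continuous_exp.tendsto _).comp (hL.div_const (β - 1))).congr' ?_
    filter_upwards [eventually_ge_atTop T] with t ht
    simp only [Function.comp]
    rw [mul_div_cancel_left₀ _ hβ.ne', Real.exp_log (hT t ht).2.1]
  obtain ⟨ε, hε, hεi, hε2⟩ := exists_tail_representation hβ.ne' hT0 hqi hq hG hgc hglim hL
  set f : ℝ → ℝ := fun u => (1 + ε u) * (β - 1) * qD a α β r p τ u with hf
  set I : ℝ → ℝ := fun s => M ^ (β - 1) * r s ^ (1 - β) * Real.exp (-∫ u in Set.Ioi s, f u) with hI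
  -- The tail integral equals L - (β-1) log v(s), so the exponential is (v(s)/M)^(β-1) and the
  -- integrand is y'(s).
  have hIe : ∀ s, T ≤ s → I s = v s ^ (β - 1) * r s ^ (1 - β) := by
    intro s hs
    simp only [hI]
    rw [hε2 s hs, neg_sub, Real.exp_sub, Real.rpow_def_of_pos hM0,
      Real.rpow_def_of_pos (hT s hs).2.1, hM, Real.log_exp, div_mul_cancel₀ _ hβ.ne',
      mul_comm (Real.log (v s))]
    field_simp
  have hIc : ContinuousOn I (Set.Icc t₀ T) := by
    have h1 : ContinuousOn (fun s => ∫ u in t₀..s, f u) (Set.uIcc t₀ T) := by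
      refine intervalIntegral.continuousOn_primitive_interval ?_
      rw [Set.uIcc_of_le hT0.le, integrableOn_Icc_iff_integrableOn_Ioc]
      exact hεi.mono_set Set.Ioc_subset_Ioi_self
    rw [Set.uIcc_of_le hT0.le] at h1
    have h2 : ContinuousOn (fun s => ∫ u in Set.Ioi s, f u) (Set.Icc t₀ T) := by
      refine (continuousOn_const (c := ∫ u in Set.Ioi t₀, f u) |>.sub h1).congr fun s hs => ?_
      rw [Pi.sub_apply, eq_sub_iff_add_eq', intervalIntegral.integral_of_le hs.1,
        ← setIntegral_union (Set.Ioc_disjoint_Ioi le_rfl) measurableSet_Ioi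
          (hεi.mono_set Set.Ioc_subset_Ioi_self) (hεi.mono_set (Set.Ioi_subset_Ioi hs.1)),
        Set.Ioc_union_Ioi_eq_Ioi hs.1]
    exact (continuousOn_const.mul ((W.cont_rpow _).mono fun s hs => h0.trans hs.1)).mul h2.neg.rexp
  have hIi : IntervalIntegrable I volume t₀ T :=
    ContinuousOn.intervalIntegrable (by rwa [Set.uIcc_of_le hT0.le])
  -- The integrand need not be y' on [t₀, T]; the constant A corrects for that segment.
  refine ⟨M, hM0, hvM, y T - ∫ s in t₀..T, I s, ε, hε, hεi, ?_⟩
  filter_upwards [eventually_ge_atTop T] with t ht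
  have hmem : ∀ s ∈ Set.uIcc T t, T ≤ s := fun s hs => by
    rw [Set.uIcc_of_le ht] at hs
    exact hs.1
  have hIi2 : IntervalIntegrable I volume T t := by
    refine ContinuousOn.intervalIntegrable (ContinuousOn.congr (fun s hs => ?_)
      fun s hs => hIe s (hmem s hs))
    have hs' := hmem s hs
    exact (((hT s hs').2.2.2.1.continuousAt.rpow_const (Or.inl (hT s hs').2.1.ne')).mul
      ((W.cont_rpow _).continuousAt (Ici_mem_nhds (hat s (hTt s hs'))))).continuousWithinAt
  have h1 : ∫ s in T..t, I s = y t - y T :=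
    intervalIntegral.integral_eq_sub_of_hasDerivAt (fun s hs => by
      rw [hIe s (hmem s hs)]
      exact (hT s (hmem s hs)).2.2.1) hIi2
  rw [← intervalIntegral.integral_add_adjacent_intervals hIi hIi2, h1]
  ring

theorem DelaySystem.slowVar_abs_sub {α β X K M : ℝ} {x u P T κ : ℝ → ℝ}
    (D : DelaySystem α β X K x u P T κ) (hM : Tendsto u atTop (𝓝 M)) :
    SlowVar fun s => |u s - M| := by
  have habs : ∀ s, X ≤ s → |u s - M| = M - u s := fun s hs => by
    rw [abs_sub_comm, abs_of_pos (sub_pos.2 (D.u_lt hM hs))]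
  refine ⟨⟨X, ?_, fun s hs => ?_⟩, fun c hc => ?_⟩
  · exact (continuousOn_iff_continuous_domRestrict.1
      ((D.cont_u.sub continuousOn_const).abs)).measurable
  · exact (sub_pos.2 (D.u_lt hM hs)).trans_eq (habs s hs).symm
  · rw [Real.rpow_zero]
    refine (D.ratioSlow_remainder hM c hc).congr' ?_
    filter_upwards [eventually_ge_atTop X, (tendsto_const_mul_atTop' hc).eventually
      (eventually_ge_atTop X)] with s h1 h2
    rw [habs s h1, habs _ h2]

end HalfLinear

/-! ### The main theorem. -/

open HalfLinear in
theorem theorem3p6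
    (a α β : ℝ) (hα : 1 < α) (hβ : 1 / α + 1 / β = 1)
    (r p τ : ℝ → ℝ)
    (hr : ContinuousOn r (Set.Ici a)) (hr0 : ∀ t, a ≤ t → 0 < r t)
    (hp : ContinuousOn p (Set.Ici a)) (hp0 : ∀ t, a ≤ t → 0 < p t)
    -- the delay: `τ ∈ C¹`, `τ' > 0`, `τ(t) ≤ t` on `[a, ∞)`
    (hτ : ContDiffOn ℝ 1 τ (Set.Ici a))
    (hτ' : ∀ t, a ≤ t → 0 < derivWithin τ (Set.Ici a) t)
    (hτle : ∀ t, a ≤ t → τ t ≤ t)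
    -- `∫_a^∞ r^(1-β) = ∞`
    (hrdiv : Tendsto (RD a β r) atTop atTop)
    -- `p_D ∈ RV(-α)` and `L_{p_D} → 0`
    (hpD : RegVar (pD a β r p) (-α))
    (hLpD : Tendsto (slowPart (pD a β r p) (-α)) atTop (𝓝 0))
    -- `limsup s / τ_D(s) < ∞`, `τ_D' ∈ SV`, `limsup τ_D'(s) < ∞`
    (hτD : ∃ K : ℝ, 0 < K ∧ ∀ᶠ s in atTop, s ≤ K * tauD a β r τ s)
    (hτD' : SlowVar (deriv (tauD a β r τ)))
    (hτDbdd : ∃ K : ℝ, ∀ᶠ s in atTop, deriv (tauD a β r τ) s ≤ K)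
    (y : ℝ → ℝ) (hy : IsIncSol a α r p τ y) :
    NormRegVar (fun s => y (RDinv a β r s)) 1 ∧
    -- `t₀` is any point of `[a, ∞)` from which on `τ_D ∘ R_D` and `q_D` are defined
    ∀ t₀ : ℝ, a ≤ t₀ → a ≤ τ t₀ →
      (Tendsto (fun t => ∫ s in t₀..t, qD a α β r p τ s) atTop atTop →
        IsIncSolInfInf a α r p τ y ∧
        ∃ ε : ℝ → ℝ, Tendsto ε atTop (𝓝 0) ∧
          (∀ t, t₀ ≤ t →
            IntervalIntegrable (fun s => (1 + ε s) * (β - 1) * qD a α β r p τ s) volume t₀ t) ∧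
          ∀ᶠ t in atTop,
            y t = RD a β r t *
              Real.exp (∫ s in t₀..t, (1 + ε s) * (β - 1) * qD a α β r p τ s)) ∧
      (IntegrableOn (qD a α β r p τ) (Set.Ioi t₀) →
        IsIncSolInfB a α r p τ y ∧
        ∃ M : ℝ, 0 < M ∧ Tendsto (quasiDeriv α r y) atTop (𝓝 M) ∧
          (∃ A : ℝ, ∃ ε : ℝ → ℝ, Tendsto ε atTop (𝓝 0) ∧
            IntegrableOn (fun u => (1 + ε u) * (β - 1) * qD a α β r p τ u) (Set.Ioi t₀) ∧
            ∀ᶠ t in atTop,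
              y t = A + ∫ s in t₀..t, M ^ (β - 1) * r s ^ (1 - β) *
                Real.exp (-∫ u in Set.Ioi s, (1 + ε u) * (β - 1) * qD a α β r p τ u)) ∧
          SlowVar (fun s => |quasiDeriv α r y (RDinv a β r s) - M|) ∧
          Tendsto (fun t => deriv (tauD a β r τ) (RD a β r t) ^ (α - 1) * RD a β r t ^ α *
              p t * r t ^ (β - 1) / (M - quasiDeriv α r y t)) atTop (𝓝 0)) := by
  have hαβ : (β - 1) * (α - 1) = 1 := by
    have hα0 : α ≠ 0 := by linarith
    have hβ0 : β ≠ 0 := by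
      rintro rfl
      rw [div_zero, add_zero, div_eq_one_iff_eq hα0] at hβ
      linarith
    field_simp at hβ
    linarith
  have W : DivergentWeight a β r := ⟨hr, hr0, hrdiv⟩
  have Θ : SmoothDelay a τ := ⟨hτ, hτ', hτle⟩
  obtain ⟨X, K, D⟩ := exists_delaySystem hα hαβ W Θ hp hp0 hpD hLpD hτD hτD' hy
  have hyinf : Tendsto y atTop atTop := by
    refine (D.tendsto_x.comp W.tendsto_RD).congr' ?_
    filter_upwards [eventually_ge_atTop a] with t ht
    simp only [Function.comp, W.RDinv_RD ht]
  refine ⟨D.normRegVar_x, fun t₀ h0 hτ0 => ⟨fun hdiv => ?_, fun hint => ?_⟩⟩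
  · obtain ⟨h1, h2⟩ := infInf_of_divergent hαβ W Θ D hp0 hy h0 hτ0
      (fun t ht => Θ.qD_intervalIntegrable W hα hp h0 hτ0 ht) hdiv
    exact ⟨⟨hy, hyinf, h1⟩, h2⟩
  · obtain ⟨M, hM0, hM, hrep⟩ := infB_of_convergent hαβ W Θ D hp0 hy h0 hτ0 hint
    have hMs := hM.comp W.tendsto_RDinv
    refine ⟨⟨hy, hyinf, M, hM0.ne', hM⟩, M, hM0, hM, hrep, D.slowVar_abs_sub hMs, ?_⟩
    -- At s = R_D(t), s Q(s) is the numerator of the claimed limit, since R_D^α = R_D^(α-1) R_D.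
    refine ((D.tendsto_sQ_div_remainder hMs).comp W.tendsto_RD).congr' ?_
    filter_upwards [eventually_gt_atTop a, W.tendsto_RD.eventually (eventually_ge_atTop X)]
      with t ht hX
    have hR := W.RD_pos ht
    have hα' : RD a β r t ^ α = RD a β r t ^ (α - 1) * RD a β r t := by
      rw [← Real.rpow_add_one hR.ne', sub_add_cancel]
    simp only [Function.comp]
    rw [Real.mul_rpow (D.κ_pos _ hX).le hR.le, pD, W.RDinv_RD ht.le, hα']
    ring
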